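/- Work over $\mathbb C$. A quasi-projective variety is a Zariski locally closed subset of a complex projective space (not necessarily irreducible), and morphisms are regular maps. Let $K(\mathsf V)$ be the Grothendieck ring of quasi-projective varieties: the abelian group generated by the isomorphism classes $[X]$ of quasi-projective varieties, subject to the relations $[X]=[X\setminus Y]+[Y]$ for $Y$ a closed subvariety of $X$, with the commutative product $[X][Y]=[X\times Y]$ and the unit $1=[\mathrm{pt}]$. Write $[\mathbb A]$ for the class of the affine line. For integers $r\ge 0$ and $d\ge 0$ let $\mathrm{Map}(r,d)$ be the variety of algebraic maps of degree $d$ from $\mathbb P^1$ to $\mathbb P^r$: it is the open subvariety of the projective space $\mathbb P^{(r+1)(d+1)-1}$ formed by the classes $[f_0:\dots:f_r]$ of sequences of binary forms of degree $d$ over $\mathbb C$ without common zero in $\mathbb P^1$, and $[f_0:\dots:f_r]$ corresponds to the map $p\mapsto[f_0(p):\dots:f_r(p)]$. Proposition. Let $r\ge 0$. 1. For every $d\ge0$, $\mathrm{Map}(r,d)$ is the fine moduli space of algebraic maps of degree $d$ from $\mathbb P^1$ to $\mathbb P^r$: the evaluation $\mathrm{Map}(r,d)\times\mathbb P^1\to\mathbb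 P^r$ is a regular map of degree $d$ on each fibre $\{f\}\times\mathbb P^1$, and for every quasi-projective variety $T$, every regular map $T\times\mathbb P^1\to\mathbb P^r$ of degree $d$ on each fibre $\{t\}\times\mathbb P^1$ is the pullback of the evaluation along a unique regular map $T\to\mathrm{Map}(r,d)$. 2. In $K(\mathsf V)$ one has $$[\mathrm{Map}(r,d)]=\begin{cases}[\mathbb P^r], & d=0,\\ [\mathbb A]^{(d-1)(r+1)+1}\,([\mathbb A]^r-1)\,[\mathbb P^r], & d>0.\end{cases}$$ 3. Equivalently, in the power series ring $K(\mathsf V)[[q]]$, where $1-q[\mathbb A]^{r+1}$ is invertible, $$\sum_{d=0}^\infty q^d\,[\mathrm{Map}(r,d)]=\frac{1-q[\mathbb A]}{1-q[\mathbb A]^{r+1}}\,[\mathbb P^r].$$ -/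

import Mathlib

namespace QuasiProj

open MvPolynomial

/-- The projective space over `ℂ` with homogeneous coordinates indexed by `ι`. -/
abbrev ProjSpace (ι : Type) : Type := Projectivization ℂ (ι → ℂ)

/-- Zariski closed subsets of projective space: common zero loci of sets of homogeneous
polynomials (of possibly different degrees). -/
def IsZariskiClosed {ι : Type} (A : Set (ProjSpace ι)) : Prop :=
  ∃ S : Set (MvPolynomial ι ℂ), (∀ f ∈ S, ∃ n, f.IsHomogeneous n) ∧
    A = {p | ∀ f ∈ S, eval p.rep f = 0}

/-- Locally closed subsets: a closed set minus a closed set. -/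
def IsZariskiLocallyClosed {ι : Type} (X : Set (ProjSpace ι)) : Prop :=
  ∃ A B : Set (ProjSpace ι), IsZariskiClosed A ∧ IsZariskiClosed B ∧ X = A \ B

/-- A quasi-projective variety over `ℂ` (not necessarily irreducible, possibly empty): a Zariski
locally closed subset of a projective space. -/
@[ext]
structure Variety : Type 1 where
  /-- index set of the homogeneous coordinates of the ambient projective space -/
  ι : Type
  [finite_ι : Finite ι]
  carrier : Set (ProjSpace ι)
  locallyClosed : IsZariskiLocallyClosed carrier

/-- `f : X → Y` is a regular map (a morphism of varieties): near every point it is given by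
homogeneous polynomials of one and the same degree, without common zero. The neighbourhood is the
open set where these polynomials do not vanish simultaneously. -/
def IsRegular {X Y : Variety} (f : X.carrier → Y.carrier) : Prop :=
  ∀ x : X.carrier, ∃ (n : ℕ) (F : Y.ι → MvPolynomial X.ι ℂ),
    (∀ i, (F i).IsHomogeneous n) ∧ (fun i => eval x.1.rep (F i)) ≠ 0 ∧
    ∀ (y : X.carrier) (hy : (fun i => eval y.1.rep (F i)) ≠ 0),
      (f y).1 = Projectivization.mk ℂ (fun i => eval y.1.rep (F i)) hy

/-- Two varieties are isomorphic if there is a bijection between them that is regular in both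
directions. -/
def Isomorphic (X Y : Variety) : Prop :=
  ∃ e : X.carrier ≃ Y.carrier, IsRegular e ∧ IsRegular e.symm

theorem eval_smul {ι : Type} {f : MvPolynomial ι ℂ} {n : ℕ} (hf : f.IsHomogeneous n) (a : ℂ)
    (v : ι → ℂ) : eval (a • v) f = a ^ n * eval v f := by
  classical
  rw [eval_eq, eval_eq, Finset.mul_sum]
  refine Finset.sum_congr rfl fun d hd => ?_
  have : ∑ i ∈ d.support, d i = n := by
    have := hf.degree_eq_sum_deg_support hd
    simpa [Finsupp.degree] using this.symm
  simp only [Pi.smul_apply, smul_eq_mul, mul_pow, Finset.prod_mul_distrib,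
    Finset.prod_pow_eq_pow_sum, this]
  ring

theorem mk_congr {ι : Type} {v w : ι → ℂ} (hv : v ≠ 0) (hw : w ≠ 0) (a : ℂ) (h : a • w = v) :
    Projectivization.mk ℂ v hv = Projectivization.mk ℂ w hw :=
  (Projectivization.mk_eq_mk_iff' ℂ v w hv hw).2 ⟨a, h⟩

theorem exists_rep_eq_smul {ι : Type} (v : ι → ℂ) (hv : v ≠ 0) :
    ∃ a : ℂ, a ≠ 0 ∧ (Projectivization.mk ℂ v hv).rep = a • v := by
  obtain ⟨a, ha⟩ := Projectivization.exists_smul_eq_mk_rep ℂ v hv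
  exact ⟨a, a.ne_zero, ha.symm⟩

theorem eval_rep_eq_zero {ι : Type} {f : MvPolynomial ι ℂ} {n : ℕ} (hf : f.IsHomogeneous n)
    (v : ι → ℂ) (hv : v ≠ 0) :
    eval (Projectivization.mk ℂ v hv).rep f = 0 ↔ eval v f = 0 := by
  obtain ⟨a, ha, h⟩ := exists_rep_eq_smul v hv
  rw [h, eval_smul hf]
  simp [ha]

theorem isRegular_of_reindex {X Y : Variety} (f : X.carrier → Y.carrier) (e : Y.ι → X.ι)
    (h : ∀ x, ∃ hx : (fun i => x.1.rep (e i)) ≠ 0,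
      (f x).1 = Projectivization.mk ℂ (fun i => x.1.rep (e i)) hx) : IsRegular f := by
  intro x
  refine ⟨1, fun i => MvPolynomial.X (e i), fun i => isHomogeneous_X ℂ _, ?_, fun y hy => ?_⟩
  · simpa using (h x).1
  · simpa using (h y).2

theorem Isomorphic.refl (X : Variety) : Isomorphic X X := by
  have : IsRegular (fun x : X.carrier => x) :=
    isRegular_of_reindex _ id fun x =>
      ⟨x.1.rep_nonzero, (Projectivization.mk_rep x.1).symm⟩
  exact ⟨Equiv.refl _, this, this⟩

theorem Isomorphic.symm {X Y : Variety} : Isomorphic X Y → Isomorphic Y X :=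
  fun ⟨e, h, h'⟩ => ⟨e.symm, h', h⟩

theorem eval_bind {ι κ : Type} (F : κ → MvPolynomial ι ℂ) (G : MvPolynomial κ ℂ) (v : ι → ℂ) :
    eval v (aeval F G) = eval (fun i => eval v (F i)) G := by
  rw [aeval_eq_bind₁]
  exact eval₂Hom_bind₁ (RingHom.id ℂ) v F G

theorem isHomogeneous_aeval {ι κ : Type} {F : κ → MvPolynomial ι ℂ} {G : MvPolynomial κ ℂ}
    {n m : ℕ} (hG : G.IsHomogeneous m) (hF : ∀ i, (F i).IsHomogeneous n) :
    (aeval F G).IsHomogeneous (n * m) :=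
  hG.aeval F hF

theorem IsRegular.comp {X Y Z : Variety} {g : Y.carrier → Z.carrier} {f : X.carrier → Y.carrier}
    (hg : IsRegular g) (hf : IsRegular f) : IsRegular (g ∘ f) := by
  intro x
  obtain ⟨n, F, hF, hF0, hFe⟩ := hf x
  obtain ⟨m, G, hG, hG0, hGe⟩ := hg (f x)
  have key : ∀ y : X.carrier, (fun i => eval y.1.rep (F i)) ≠ 0 → ∃ a : ℂ, a ≠ 0 ∧
      (fun k => eval (f y).1.rep (G k)) = a • fun k => eval y.1.rep (aeval F (G k)) := by
    intro y hy
    obtain ⟨a, ha, h⟩ := exists_rep_eq_smul _ hy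
    rw [← hFe y hy] at h
    refine ⟨a ^ m, pow_ne_zero _ ha, _root_.funext fun k => ?_⟩
    rw [h, eval_smul (hG k), Pi.smul_apply, eval_bind, smul_eq_mul]
  -- either `G` has degree `0`, or the composite does not vanish only where `F` does not
  have key' : ∀ y : X.carrier, (fun k => eval y.1.rep (aeval F (G k))) ≠ 0 → ∃ a : ℂ, a ≠ 0 ∧
      (fun k => eval (f y).1.rep (G k)) = a • fun k => eval y.1.rep (aeval F (G k)) := by
    intro y hy
    by_cases h : (fun i => eval y.1.rep (F i)) = 0
    · simp only [eval_bind, h] at hy ⊢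
      have h0 : ∀ k, eval (0 : Y.ι → ℂ) (G k) = 0 ^ m * eval (f y).1.rep (G k) := fun k => by
        rw [← eval_smul (hG k), zero_smul]
      refine ⟨1, one_ne_zero, ?_⟩
      rcases Nat.eq_zero_or_pos m with rfl | hm
      · exact _root_.funext fun k => by simpa using (h0 k).symm
      · exact absurd (_root_.funext fun k => by rw [h0]; simp [hm.ne']) hy
    · exact key y h
  refine ⟨n * m, fun k => aeval F (G k), fun k => isHomogeneous_aeval (hG k) hF, ?_, ?_⟩
  · obtain ⟨a, ha, h⟩ := key x hF0
    intro h0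
    rw [h0, smul_zero] at h
    exact hG0 h
  · intro y hy
    obtain ⟨a, ha, h⟩ := key' y hy
    have hy' : (fun k => eval (f y).1.rep (G k)) ≠ 0 := by
      rw [h]
      exact smul_ne_zero ha hy
    exact (hGe (f y) hy').trans (mk_congr _ _ a h.symm)

theorem Isomorphic.trans {X Y Z : Variety} : Isomorphic X Y → Isomorphic Y Z → Isomorphic X Z :=
  fun ⟨e, h, h'⟩ ⟨f, k, k'⟩ => ⟨e.trans f, k.comp h, h'.comp k'⟩

/-! ### Closed sets -/

theorem isZariskiClosed_univ {ι : Type} : IsZariskiClosed (Set.univ : Set (ProjSpace ι)) :=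
  ⟨∅, by simp, by simp⟩

theorem isZariskiClosed_empty {ι : Type} : IsZariskiClosed (∅ : Set (ProjSpace ι)) :=
  ⟨{1}, by simpa using ⟨0, isHomogeneous_one ι ℂ⟩, by simp⟩

theorem IsZariskiClosed.inter {ι : Type} {A B : Set (ProjSpace ι)} (hA : IsZariskiClosed A)
    (hB : IsZariskiClosed B) : IsZariskiClosed (A ∩ B) := by
  obtain ⟨S, hS, rfl⟩ := hA
  obtain ⟨T, hT, rfl⟩ := hB
  refine ⟨S ∪ T, fun f hf => hf.elim (hS f) (hT f), ?_⟩
  ext p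
  simp [or_imp, forall_and]

theorem IsZariskiClosed.union {ι : Type} {A B : Set (ProjSpace ι)} (hA : IsZariskiClosed A)
    (hB : IsZariskiClosed B) : IsZariskiClosed (A ∪ B) := by
  obtain ⟨S, hS, rfl⟩ := hA
  obtain ⟨T, hT, rfl⟩ := hB
  refine ⟨{h | ∃ f ∈ S, ∃ g ∈ T, h = f * g}, ?_, ?_⟩
  · rintro _ ⟨f, hf, g, hg, rfl⟩
    obtain ⟨n, hn⟩ := hS f hf
    obtain ⟨m, hm⟩ := hT g hg
    exact ⟨n + m, hn.mul hm⟩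
  · ext p
    simp only [Set.mem_union, Set.mem_ofPred_eq]
    constructor
    · rintro (h | h) _ ⟨f, hf, g, hg, rfl⟩
      · simp [h f hf]
      · simp [h g hg]
    · intro h
      by_contra! hc
      obtain ⟨⟨f, hf, hf0⟩, g, hg, hg0⟩ := hc
      exact mul_ne_zero hf0 hg0 (by simpa using h _ ⟨f, hf, g, hg, rfl⟩)

theorem IsZariskiClosed.locallyClosed {ι : Type} {A : Set (ProjSpace ι)} (hA : IsZariskiClosed A) :
    IsZariskiLocallyClosed A :=
  ⟨A, ∅, hA, isZariskiClosed_empty, by simp⟩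

theorem IsZariskiClosed.compl_locallyClosed {ι : Type} {A : Set (ProjSpace ι)}
    (hA : IsZariskiClosed A) : IsZariskiLocallyClosed Aᶜ :=
  ⟨Set.univ, A, isZariskiClosed_univ, hA, by simp [Set.compl_eq_univ_sdiff]⟩

theorem IsZariskiLocallyClosed.inter {ι : Type} {X A : Set (ProjSpace ι)}
    (hX : IsZariskiLocallyClosed X) (hA : IsZariskiClosed A) : IsZariskiLocallyClosed (X ∩ A) := by
  obtain ⟨B, C, hB, hC, rfl⟩ := hX
  refine ⟨B ∩ A, C, hB.inter hA, hC, ?_⟩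
  ext p
  simp only [Set.mem_inter_iff, Set.mem_sdiff]
  tauto

theorem IsZariskiLocallyClosed.diff {ι : Type} {X A : Set (ProjSpace ι)}
    (hX : IsZariskiLocallyClosed X) (hA : IsZariskiClosed A) : IsZariskiLocallyClosed (X \ A) := by
  obtain ⟨B, C, hB, hC, rfl⟩ := hX
  refine ⟨B, C ∪ A, hB, hC.union hA, ?_⟩
  ext p
  simp only [Set.mem_union, Set.mem_sdiff]
  tauto

/-- The closed subvariety `X ∩ A` of `X`, for `A` closed in the ambient projective space. -/
abbrev Variety.interClosed (X : Variety) (A : Set (ProjSpace X.ι)) (hA : IsZariskiClosed A) :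
    Variety :=
  { X with carrier := X.carrier ∩ A, locallyClosed := X.locallyClosed.inter hA }

/-- The complement `X \ A` of the closed subvariety `X ∩ A` of `X`. -/
abbrev Variety.diffClosed (X : Variety) (A : Set (ProjSpace X.ι)) (hA : IsZariskiClosed A) :
    Variety :=
  { X with carrier := X.carrier \ A, locallyClosed := X.locallyClosed.diff hA }

/-! ### Products, by the Segre embedding -/

theorem segre_ne_zero {ι κ : Type} {v : ι → ℂ} {w : κ → ℂ} (hv : v ≠ 0) (hw : w ≠ 0) :
    (fun ij : ι × κ => v ij.1 * w ij.2) ≠ 0 := by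
  obtain ⟨i, hi⟩ := Function.ne_iff.1 hv
  obtain ⟨j, hj⟩ := Function.ne_iff.1 hw
  exact Function.ne_iff.2 ⟨(i, j), mul_ne_zero hi hj⟩

/-- The Segre map `([xᵢ], [yⱼ]) ↦ [xᵢ yⱼ]`. -/
noncomputable def segre {ι κ : Type} (p : ProjSpace ι) (q : ProjSpace κ) : ProjSpace (ι × κ) :=
  Projectivization.mk ℂ (fun ij => p.rep ij.1 * q.rep ij.2)
    (segre_ne_zero p.rep_nonzero q.rep_nonzero)

theorem segre_rep {ι κ : Type} (p : ProjSpace ι) (q : ProjSpace κ) :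
    ∃ a : ℂ, a ≠ 0 ∧ ∀ i j, (segre p q).rep (i, j) = a * (p.rep i * q.rep j) := by
  obtain ⟨a, ha, h⟩ := exists_rep_eq_smul _ (segre_ne_zero p.rep_nonzero q.rep_nonzero)
  exact ⟨a, ha, fun i j => congrFun h (i, j)⟩

theorem segre_injective {ι κ : Type} {p p' : ProjSpace ι} {q q' : ProjSpace κ}
    (h : segre p q = segre p' q') : p = p' ∧ q = q' := by
  obtain ⟨a, ha⟩ := (Projectivization.mk_eq_mk_iff' ℂ _ _ _ _).1 h
  have ha' : ∀ i j, a * (p'.rep i * q'.rep j) = p.rep i * q.rep j := fun i j => congrFun ha (i, j)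
  obtain ⟨i, hi⟩ := Function.ne_iff.1 p.rep_nonzero
  obtain ⟨j, hj⟩ := Function.ne_iff.1 q.rep_nonzero
  simp only [Pi.zero_apply] at hi hj
  constructor
  · rw [← Projectivization.mk_rep p, ← Projectivization.mk_rep p']
    refine mk_congr _ _ (a * q'.rep j / q.rep j) (_root_.funext fun i => ?_)
    simp only [Pi.smul_apply, smul_eq_mul]
    field_simp
    linear_combination ha' i j
  · rw [← Projectivization.mk_rep q, ← Projectivization.mk_rep q']
    refine mk_congr _ _ (a * p'.rep i / p.rep i) (_root_.funext fun j => ?_)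
    simp only [Pi.smul_apply, smul_eq_mul]
    field_simp
    linear_combination ha' i j

theorem range_segre {ι κ : Type} (p : ProjSpace (ι × κ)) (h : ∀ i j k l,
    p.rep (i, j) * p.rep (k, l) = p.rep (i, l) * p.rep (k, j)) : ∃ x y, p = segre x y := by
  obtain ⟨⟨i, j⟩, hij⟩ := Function.ne_iff.1 p.rep_nonzero
  simp only [Pi.zero_apply] at hij
  have hv : (fun k => p.rep (k, j)) ≠ 0 := Function.ne_iff.2 ⟨i, hij⟩
  have hw : (fun l => p.rep (i, l)) ≠ 0 := Function.ne_iff.2 ⟨j, hij⟩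
  refine ⟨Projectivization.mk ℂ _ hv, Projectivization.mk ℂ _ hw, ?_⟩
  obtain ⟨a, ha, hae⟩ := exists_rep_eq_smul _ hv
  obtain ⟨b, hb, hbe⟩ := exists_rep_eq_smul _ hw
  refine (Projectivization.mk_rep p).symm.trans 
    (mk_congr _ _ (a⁻¹ * b⁻¹ * (p.rep (i, j))⁻¹) (_root_.funext fun kl => ?_))
  obtain ⟨k, l⟩ := kl
  simp only [Pi.smul_apply, smul_eq_mul, hae, hbe]
  field_simp
  linear_combination h k j i l

theorem isZariskiClosed_segre {ι κ : Type} {A : Set (ProjSpace ι)} {B : Set (ProjSpace κ)}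
    (hA : IsZariskiClosed A) (hB : IsZariskiClosed B) :
    IsZariskiClosed (Set.image2 segre A B) := by
  obtain ⟨S, hS, rfl⟩ := hA
  obtain ⟨T, hT, rfl⟩ := hB
  refine ⟨{h | (∃ i j k l, h = X (i, j) * X (k, l) - X (i, l) * X (k, j)) ∨
    (∃ f ∈ S, ∃ j, h = rename (fun i => (i, j)) f) ∨
    (∃ g ∈ T, ∃ i, h = rename (fun j => (i, j)) g)}, ?_, ?_⟩
  · rintro _ (⟨i, j, k, l, rfl⟩ | ⟨f, hf, j, rfl⟩ | ⟨g, hg, i, rfl⟩)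
    · exact ⟨2, ((isHomogeneous_X ℂ _).mul (isHomogeneous_X ℂ _)).sub
        ((isHomogeneous_X ℂ _).mul (isHomogeneous_X ℂ _))⟩
    · exact (hS f hf).imp fun n hn => hn.rename_isHomogeneous
    · exact (hT g hg).imp fun n hn => hn.rename_isHomogeneous
  have hf' : ∀ (x : ProjSpace ι) (y : ProjSpace κ) (f : MvPolynomial ι ℂ) (n : ℕ),
      f.IsHomogeneous n → ∀ j, ∃ c : ℂ, (y.rep j ≠ 0 → c ≠ 0) ∧
      eval (segre x y).rep (rename (fun i => (i, j)) f) = c ^ n * eval x.rep f := by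
    intro x y f n hn j
    obtain ⟨a, ha, hae⟩ := segre_rep x y
    refine ⟨a * y.rep j, fun h => mul_ne_zero ha h, ?_⟩
    rw [eval_rename, ← eval_smul hn]
    congr 2
    ext i
    simp [hae]
    ring
  have hg' : ∀ (x : ProjSpace ι) (y : ProjSpace κ) (f : MvPolynomial κ ℂ) (n : ℕ),
      f.IsHomogeneous n → ∀ i, ∃ c : ℂ, (x.rep i ≠ 0 → c ≠ 0) ∧
      eval (segre x y).rep (rename (fun j => (i, j)) f) = c ^ n * eval y.rep f := by
    intro x y f n hn i
    obtain ⟨a, ha, hae⟩ := segre_rep x y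
    refine ⟨a * x.rep i, fun h => mul_ne_zero ha h, ?_⟩
    rw [eval_rename, ← eval_smul hn]
    congr 2
    ext j
    simp [hae]
    ring
  ext p
  constructor
  · rintro ⟨x, hx, y, hy, rfl⟩ _ (⟨i, j, k, l, rfl⟩ | ⟨f, hf, j, rfl⟩ | ⟨g, hg, i, rfl⟩)
    · obtain ⟨a, ha, hae⟩ := segre_rep x y
      simp [hae]
      ring
    · obtain ⟨n, hn⟩ := hS f hf
      obtain ⟨c, -, hc⟩ := hf' x y f n hn j
      rw [hc, hx f hf, mul_zero]
    · obtain ⟨n, hn⟩ := hT g hg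
      obtain ⟨c, -, hc⟩ := hg' x y g n hn i
      rw [hc, hy g hg, mul_zero]
  · intro h
    obtain ⟨x, y, rfl⟩ := range_segre p fun i j k l => by
      simpa [sub_eq_zero] using h _ (Or.inl ⟨i, j, k, l, rfl⟩)
    obtain ⟨i, hi⟩ := Function.ne_iff.1 x.rep_nonzero
    obtain ⟨j, hj⟩ := Function.ne_iff.1 y.rep_nonzero
    refine ⟨x, fun f hf => ?_, y, fun g hg => ?_, rfl⟩
    · obtain ⟨n, hn⟩ := hS f hf
      obtain ⟨c, hc, hce⟩ := hf' x y f n hn j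
      have := h _ (Or.inr (Or.inl ⟨f, hf, j, rfl⟩))
      rw [hce] at this
      exact (mul_eq_zero.1 this).resolve_left (pow_ne_zero _ (hc hj))
    · obtain ⟨n, hn⟩ := hT g hg
      obtain ⟨c, hc, hce⟩ := hg' x y g n hn i
      have := h _ (Or.inr (Or.inr ⟨g, hg, i, rfl⟩))
      rw [hce] at this
      exact (mul_eq_zero.1 this).resolve_left (pow_ne_zero _ (hc hi))

theorem isZariskiLocallyClosed_segre {ι κ : Type} {X : Set (ProjSpace ι)} {Y : Set (ProjSpace κ)}
    (hX : IsZariskiLocallyClosed X) (hY : IsZariskiLocallyClosed Y) :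
    IsZariskiLocallyClosed (Set.image2 segre X Y) := by
  obtain ⟨A, B, hA, hB, rfl⟩ := hX
  obtain ⟨C, D, hC, hD, rfl⟩ := hY
  refine ⟨Set.image2 segre A C, Set.image2 segre B Set.univ ∪ Set.image2 segre Set.univ D,
    isZariskiClosed_segre hA hC, (isZariskiClosed_segre hB isZariskiClosed_univ).union
      (isZariskiClosed_segre isZariskiClosed_univ hD), ?_⟩
  ext p
  constructor
  · rintro ⟨x, hx, y, hy, rfl⟩
    refine ⟨⟨x, hx.1, y, hy.1, rfl⟩, ?_⟩
    rintro (⟨x', hx', y', -, h⟩ | ⟨x', -, y', hy', h⟩)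
    · exact hx.2 ((segre_injective h).1 ▸ hx')
    · exact hy.2 ((segre_injective h).2 ▸ hy')
  · rintro ⟨⟨x, hx, y, hy, rfl⟩, h⟩
    exact ⟨x, ⟨hx, fun h' => h (Or.inl ⟨x, h', y, trivial, rfl⟩)⟩, y,
      ⟨hy, fun h' => h (Or.inr ⟨x, trivial, y, h', rfl⟩)⟩, rfl⟩

/-- The Cartesian product of two varieties, as the image of the Segre embedding. -/
noncomputable abbrev Variety.prod (X Y : Variety) : Variety where
  ι := X.ι × Y.ι
  finite_ι := by
    have := X.finite_ι
    have := Y.finite_ι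
    infer_instance
  carrier := Set.image2 segre X.carrier Y.carrier
  locallyClosed := isZariskiLocallyClosed_segre X.locallyClosed Y.locallyClosed

/-- The points of `X × Y` are the pairs of a point of `X` and a point of `Y`. -/
noncomputable def Variety.prodEquiv (X Y : Variety) :
    X.carrier × Y.carrier ≃ (X.prod Y).carrier :=
  Equiv.ofBijective (fun xy => ⟨segre xy.1.1 xy.2.1, xy.1.1, xy.1.2, xy.2.1, xy.2.2, rfl⟩) <| by
    constructor
    · rintro ⟨x, y⟩ ⟨x', y'⟩ h
      obtain ⟨h, h'⟩ := segre_injective (Subtype.ext_iff.1 h)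
      exact Prod.ext (Subtype.ext h) (Subtype.ext h')
    · rintro ⟨_, x, hx, y, hy, rfl⟩
      exact ⟨(⟨x, hx⟩, ⟨y, hy⟩), rfl⟩

theorem Variety.prodEquiv_rep (X Y : Variety) (x : X.carrier) (y : Y.carrier) :
    ∃ a : ℂ, a ≠ 0 ∧ ∀ i j,
      (X.prodEquiv Y (x, y)).1.rep (i, j) = a * (x.1.rep i * y.1.rep j) :=
  segre_rep x.1 y.1

theorem IsRegular.prodMap {X Y X' Y' : Variety} {f : X.carrier → X'.carrier}
    {g : Y.carrier → Y'.carrier} (hf : IsRegular f) (hg : IsRegular g) :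
    IsRegular (X'.prodEquiv Y' ∘ Prod.map f g ∘ (X.prodEquiv Y).symm) := by
  intro z
  obtain ⟨⟨x, y⟩, rfl⟩ := (X.prodEquiv Y).surjective z
  obtain ⟨n, F, hF, hF0, hFe⟩ := hf x
  obtain ⟨m, G, hG, hG0, hGe⟩ := hg y
  obtain ⟨i, hi⟩ := Function.ne_iff.1 x.1.rep_nonzero
  obtain ⟨j, hj⟩ := Function.ne_iff.1 y.1.rep_nonzero
  have key : ∀ (x' : X.carrier) (y' : Y.carrier), ∃ a : ℂ, a ≠ 0 ∧
      (fun kl : X'.ι × Y'.ι => eval (X.prodEquiv Y (x', y')).1.rep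
        (rename (fun i => (i, j)) (F kl.1) * rename (fun j => (i, j)) (G kl.2))) =
      (a ^ n * y'.1.rep j ^ n * (a ^ m * x'.1.rep i ^ m)) •
        fun kl : X'.ι × Y'.ι => eval x'.1.rep (F kl.1) * eval y'.1.rep (G kl.2) := by
    intro x' y'
    obtain ⟨a, ha, hae⟩ := X.prodEquiv_rep Y x' y'
    refine ⟨a, ha, _root_.funext fun kl => ?_⟩
    have h1 : (X.prodEquiv Y (x', y')).1.rep ∘ (fun i => (i, j)) = (a * y'.1.rep j) • x'.1.rep := by
      ext i
      simp [hae]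
      ring
    have h2 : (X.prodEquiv Y (x', y')).1.rep ∘ (fun j => (i, j)) = (a * x'.1.rep i) • y'.1.rep := by
      ext j
      simp [hae]
      ring
    rw [Pi.smul_apply, map_mul, eval_rename, eval_rename, h1, h2, eval_smul (hF _),
      eval_smul (hG _), smul_eq_mul]
    ring
  refine ⟨n + m, fun kl => rename (fun i => (i, j)) (F kl.1) * rename (fun j => (i, j)) (G kl.2),
    fun kl => (hF _).rename_isHomogeneous.mul (hG _).rename_isHomogeneous, ?_, ?_⟩
  · obtain ⟨a, ha, h⟩ := key x y
    rw [h]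
    refine smul_ne_zero ?_ (segre_ne_zero hF0 hG0)
    have : x.1.rep i ≠ 0 := hi
    have : y.1.rep j ≠ 0 := hj
    positivity
  · intro z' hz'
    obtain ⟨⟨x', y'⟩, rfl⟩ := (X.prodEquiv Y).surjective z'
    obtain ⟨a, ha, h⟩ := key x' y'
    have hx' : (fun k => eval x'.1.rep (F k)) ≠ 0 := by
      intro h0
      rw [h] at hz'
      exact hz' (_root_.funext fun kl => by simp [congrFun h0 kl.1])
    have hy' : (fun k => eval y'.1.rep (G k)) ≠ 0 := by
      intro h0
      rw [h] at hz'
      exact hz' (_root_.funext fun kl => by simp [congrFun h0 kl.2])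
    obtain ⟨b, hb, hbe⟩ := exists_rep_eq_smul _ hx'
    obtain ⟨c, hc, hce⟩ := exists_rep_eq_smul _ hy'
    rw [← hFe x' hx'] at hbe
    rw [← hGe y' hy'] at hce
    simp only [Function.comp_apply, Equiv.symm_apply_apply, Prod.map_apply]
    symm
    refine mk_congr _ _ ((a ^ n * y'.1.rep j ^ n * (a ^ m * x'.1.rep i ^ m)) * b⁻¹ * c⁻¹) ?_
    refine Eq.trans ?_ h.symm
    ext kl
    simp only [hbe, hce, Pi.smul_apply, smul_eq_mul]
    field_simp

theorem Isomorphic.prod {X Y X' Y' : Variety} :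
    Isomorphic X X' → Isomorphic Y Y' → Isomorphic (X.prod Y) (X'.prod Y') :=
  fun ⟨e, h, h'⟩ ⟨f, k, k'⟩ =>
    ⟨(X.prodEquiv Y).symm.trans ((e.prodCongr f).trans (X'.prodEquiv Y')),
      h.prodMap k, h'.prodMap k'⟩

/-- Varieties up to isomorphism. -/
instance isoSetoid : Setoid Variety where
  r := Isomorphic
  iseqv := ⟨Isomorphic.refl, Isomorphic.symm, Isomorphic.trans⟩

/-- The isomorphism classes of quasi-projective varieties over `ℂ`. -/
def IsoClass : Type 1 := Quotient isoSetoid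

/-- The projective space `ℙʳ`. -/
abbrev projSpace (r : ℕ) : Variety where
  ι := Fin (r + 1)
  carrier := Set.univ
  locallyClosed := isZariskiClosed_univ.locallyClosed

theorem prod_comm_iso (X Y : Variety) : Isomorphic (X.prod Y) (Y.prod X) := by
  have key : ∀ X Y : Variety, IsRegular
      ((X.prodEquiv Y).symm.trans ((Equiv.prodComm _ _).trans (Y.prodEquiv X))) := by
    intro X Y
    refine isRegular_of_reindex _ (fun ji => (ji.2, ji.1)) fun z => ?_
    obtain ⟨⟨x, y⟩, rfl⟩ := (X.prodEquiv Y).surjective z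
    obtain ⟨a, ha, hae⟩ := X.prodEquiv_rep Y x y
    have h : (fun ji : Y.ι × X.ι => (X.prodEquiv Y (x, y)).1.rep (ji.2, ji.1)) =
        a • fun ji : Y.ι × X.ι => y.1.rep ji.1 * x.1.rep ji.2 := by
      ext ji
      simp [hae, mul_comm]
    have h0 := segre_ne_zero y.1.rep_nonzero x.1.rep_nonzero
    refine ⟨h ▸ smul_ne_zero ha h0, ?_⟩
    simp only [Equiv.trans_apply, Equiv.symm_apply_apply, Equiv.prodComm_apply, Prod.swap_prod_mk]
    exact (mk_congr _ h0 a h.symm).symm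
  exact ⟨_, key X Y, key Y X⟩

theorem prod_assoc_iso (X Y Z : Variety) :
    Isomorphic ((X.prod Y).prod Z) (X.prod (Y.prod Z)) := by
  let e : ((X.prod Y).prod Z).carrier ≃ (X.prod (Y.prod Z)).carrier :=
    ((X.prod Y).prodEquiv Z).symm.trans <|
      (((X.prodEquiv Y).symm.prodCongr (Equiv.refl _)).trans <|
        (Equiv.prodAssoc _ _ _).trans <| (Equiv.refl _).prodCongr (Y.prodEquiv Z)).trans <|
      X.prodEquiv (Y.prod Z)
  have he : ∀ x y z, e ((X.prod Y).prodEquiv Z (X.prodEquiv Y (x, y), z)) =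
      X.prodEquiv (Y.prod Z) (x, Y.prodEquiv Z (y, z)) := by
    intro x y z
    simp [e]
  have hrep : ∀ x y z, ∃ a : ℂ, a ≠ 0 ∧ ∀ i j k,
      ((X.prod Y).prodEquiv Z (X.prodEquiv Y (x, y), z)).1.rep ((i, j), k) =
        a * (X.prodEquiv (Y.prod Z) (x, Y.prodEquiv Z (y, z))).1.rep (i, (j, k)) := by
    intro x y z
    obtain ⟨a, ha, hae⟩ := X.prodEquiv_rep Y x y
    obtain ⟨b, hb, hbe⟩ := Y.prodEquiv_rep Z y z
    obtain ⟨c, hc, hce⟩ := (X.prod Y).prodEquiv_rep Z (X.prodEquiv Y (x, y)) z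
    obtain ⟨d, hd, hde⟩ := X.prodEquiv_rep (Y.prod Z) x (Y.prodEquiv Z (y, z))
    refine ⟨c * a * b⁻¹ * d⁻¹, by positivity, fun i j k => ?_⟩
    have h1 := hce (i, j) k
    have h2 := hde i (j, k)
    rw [hae] at h1
    rw [hbe] at h2
    rw [h1, h2]
    field_simp
  refine ⟨e, isRegular_of_reindex _ (fun ijk => ((ijk.1, ijk.2.1), ijk.2.2)) fun w => ?_,
    isRegular_of_reindex _ (fun ijk => (ijk.1.1, (ijk.1.2, ijk.2))) fun w => ?_⟩
  · obtain ⟨⟨w, z⟩, rfl⟩ := ((X.prod Y).prodEquiv Z).surjective w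
    obtain ⟨⟨x, y⟩, rfl⟩ := (X.prodEquiv Y).surjective w
    obtain ⟨a, ha, hae⟩ := hrep x y z
    have h0 := (X.prodEquiv (Y.prod Z) (x, Y.prodEquiv Z (y, z))).1.rep_nonzero
    have h := _root_.funext fun ijk : X.ι × (Y.ι × Z.ι) => hae ijk.1 ijk.2.1 ijk.2.2
    refine ⟨fun h' => smul_ne_zero ha h0 (h.symm.trans h'), ?_⟩
    rw [he]
    exact (Projectivization.mk_rep _).symm.trans (mk_congr _ h0 a h.symm).symm
  · obtain ⟨w, rfl⟩ := e.surjective w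
    obtain ⟨⟨w, z⟩, rfl⟩ := ((X.prod Y).prodEquiv Z).surjective w
    obtain ⟨⟨x, y⟩, rfl⟩ := (X.prodEquiv Y).surjective w
    obtain ⟨a, ha, hae⟩ := hrep x y z
    have h0 := ((X.prod Y).prodEquiv Z (X.prodEquiv Y (x, y), z)).1.rep_nonzero
    have h := _root_.funext fun ijk : (X.ι × Y.ι) × Z.ι => hae ijk.1.1 ijk.1.2 ijk.2
    rw [Equiv.symm_apply_apply, he]
    have h1 := h0
    refine ⟨fun h' => h0 (h.trans ?_), ?_⟩
    · exact (congrArg (a • ·) h').trans (smul_zero a)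
    exact (Projectivization.mk_rep _).symm.trans (mk_congr h0 _ a h.symm)

theorem point_prod_iso (X : Variety) : Isomorphic ((projSpace 0).prod X) X := by
  have hs : Subsingleton (projSpace 0).carrier := by
    refine ⟨fun p q => Subtype.ext ?_⟩
    rw [← Projectivization.mk_rep p.1, ← Projectivization.mk_rep q.1]
    have h0 : q.1.rep (0 : Fin 1) ≠ 0 := fun h => q.1.rep_nonzero <| _root_.funext fun i => by
      rwa [Subsingleton.elim (α := Fin 1) i 0]
    refine mk_congr _ _ (p.1.rep (0 : Fin 1) / q.1.rep (0 : Fin 1)) <| _root_.funext fun i => ?_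
    rw [Subsingleton.elim (α := Fin 1) i 0]
    simp [h0]
  have hv : (fun _ : Fin 1 => (1 : ℂ)) ≠ 0 := Function.ne_iff.2 ⟨0, one_ne_zero⟩
  let o : (projSpace 0).carrier := ⟨Projectivization.mk ℂ _ hv, trivial⟩
  let : Unique (projSpace 0).carrier := ⟨⟨o⟩, fun _ => Subsingleton.elim _ _⟩
  let e : ((projSpace 0).prod X).carrier ≃ X.carrier :=
    ((projSpace 0).prodEquiv X).symm.trans (Equiv.uniqueProd _ _)
  have ho : ∀ i : Fin 1, o.1.rep i ≠ 0 := fun i h => o.1.rep_nonzero <| _root_.funext fun j => by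
    rwa [Subsingleton.elim (α := Fin 1) j i]
  have hrep : ∀ x : X.carrier, ∃ a : ℂ, a ≠ 0 ∧ ∀ (i : Fin 1) (j : X.ι),
      ((projSpace 0).prodEquiv X (o, x)).1.rep (i, j) = a * x.1.rep j := by
    intro x
    obtain ⟨a, ha, hae⟩ := (projSpace 0).prodEquiv_rep X o x
    refine ⟨a * o.1.rep (0 : Fin 1), mul_ne_zero ha (ho 0), fun i j => ?_⟩
    rw [Subsingleton.elim (α := Fin 1) i 0, mul_assoc]
    exact hae 0 j
  have he : ∀ x : X.carrier, e.symm x = (projSpace 0).prodEquiv X (o, x) := fun x => rfl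
  refine ⟨e, isRegular_of_reindex _ (fun j => ((0 : Fin 1), j)) fun w => ?_,
    isRegular_of_reindex _ (fun ij => ij.2) fun x => ?_⟩
  · obtain ⟨x, rfl⟩ := e.symm.surjective w
    obtain ⟨a, ha, hae⟩ := hrep x
    have h := _root_.funext fun j => hae 0 j
    refine ⟨fun h' => smul_ne_zero ha x.1.rep_nonzero (h.symm.trans h'), ?_⟩
    rw [Equiv.apply_symm_apply]
    exact (Projectivization.mk_rep _).symm.trans (mk_congr _ x.1.rep_nonzero a h.symm).symm
  · obtain ⟨a, ha, hae⟩ := hrep x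
    have h0 := ((projSpace 0).prodEquiv X (o, x)).1.rep_nonzero
    have h := _root_.funext fun ij : Fin 1 × X.ι => hae ij.1 ij.2
    refine ⟨fun h' => h0 (h.trans ((congrArg (a • ·) h').trans (smul_zero a))), ?_⟩
    rw [he]
    exact (Projectivization.mk_rep _).symm.trans (mk_congr h0 _ a h.symm)

/-- Isomorphism classes form a commutative monoid under the Cartesian product, with the class of
the point `ℙ⁰` as its identity. -/
noncomputable instance : CommMonoid IsoClass where
  mul := Quotient.map₂ Variety.prod fun _ _ h _ _ h' => h.prod h'
  one := Quotient.mk _ (projSpace 0)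
  mul_assoc := by
    rintro ⟨X⟩ ⟨Y⟩ ⟨Z⟩
    exact Quotient.sound (prod_assoc_iso X Y Z)
  mul_comm := by
    rintro ⟨X⟩ ⟨Y⟩
    exact Quotient.sound (prod_comm_iso X Y)
  one_mul := by
    rintro ⟨X⟩
    exact Quotient.sound (point_prod_iso X)
  mul_one := by
    rintro ⟨X⟩
    exact Quotient.sound ((prod_comm_iso X _).trans (point_prod_iso X))

/-! ### The Grothendieck group of varieties -/

/-- The free generator attached to a variety; it only depends on its isomorphism class. -/
noncomputable def gen (X : Variety) : FreeAbelianGroup IsoClass :=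
  FreeAbelianGroup.of (Quotient.mk isoSetoid X)

/-- The scissor relations `[X] - ([X \ Y] + [Y])`, for `Y = X ∩ A` a closed subvariety of `X`. -/
def scissorRelations : Set (FreeAbelianGroup IsoClass) :=
  {a | ∃ (X : Variety) (A : Set (ProjSpace X.ι)) (hA : IsZariskiClosed A),
    a = gen X - (gen (X.diffClosed A hA) + gen (X.interClosed A hA))}

theorem gen_mul (X Y : Variety) : gen X * gen Y = gen (X.prod Y) :=
  (FreeAbelianGroup.of_mul_of _ _)

theorem gen_mul_scissor (Z : Variety) {a : FreeAbelianGroup IsoClass} (ha : a ∈ scissorRelations) :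
    gen Z * a ∈ scissorRelations := by
  obtain ⟨X, A, hA, rfl⟩ := ha
  have hB : IsZariskiClosed (Set.image2 segre (Set.univ : Set (ProjSpace Z.ι)) A) :=
    isZariskiClosed_segre isZariskiClosed_univ hA
  refine ⟨Z.prod X, _, hB, ?_⟩
  have h1 : Z.prod (X.diffClosed A hA) = (Z.prod X).diffClosed _ hB := by
    refine Variety.ext rfl (heq_of_eq ?_)
    ext p
    constructor
    · rintro ⟨z, hz, x, hx, rfl⟩
      refine ⟨⟨z, hz, x, hx.1, rfl⟩, ?_⟩
      rintro ⟨z', -, x', hx', h⟩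
      exact hx.2 ((segre_injective h).2 ▸ hx')
    · rintro ⟨⟨z, hz, x, hx, rfl⟩, h⟩
      exact ⟨z, hz, x, ⟨hx, fun h' => h ⟨z, trivial, x, h', rfl⟩⟩, rfl⟩
  have h2 : Z.prod (X.interClosed A hA) = (Z.prod X).interClosed _ hB := by
    refine Variety.ext rfl (heq_of_eq ?_)
    ext p
    constructor
    · rintro ⟨z, hz, x, hx, rfl⟩
      exact ⟨⟨z, hz, x, hx.1, rfl⟩, z, trivial, x, hx.2, rfl⟩
    · rintro ⟨⟨z, hz, x, hx, rfl⟩, z', -, x', hx', h⟩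
      exact ⟨z, hz, x, ⟨hx, (segre_injective h).2 ▸ hx'⟩, rfl⟩
  rw [mul_sub, mul_add, gen_mul, gen_mul, gen_mul, h1, h2]

theorem mul_mem_scissor (b : FreeAbelianGroup IsoClass) {a : FreeAbelianGroup IsoClass}
    (ha : a ∈ AddSubgroup.closure scissorRelations) :
    b * a ∈ AddSubgroup.closure scissorRelations := by
  induction b using FreeAbelianGroup.induction_on with
  | zero => simp
  | of x =>
    obtain ⟨Z, rfl⟩ := Quotient.exists_rep x
    change gen Z * a ∈ _
    induction ha using AddSubgroup.closure_induction with
    | mem a ha => exact AddSubgroup.subset_closure (gen_mul_scissor Z ha)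
    | zero => simp
    | add a b _ _ ha hb => simpa [mul_add] using add_mem ha hb
    | neg a _ ha => simpa using ha
  | neg x h => simpa using h
  | add x y hx hy => simpa [add_mul] using add_mem hx hy

/-- The additive subgroup generated by the scissor relations. It is stable under products with
arbitrary varieties, that is, it is an ideal. -/
noncomputable def scissorIdeal : Ideal (FreeAbelianGroup IsoClass) where
  __ := AddSubgroup.closure scissorRelations
  smul_mem' b _ ha := mul_mem_scissor b ha

/-- `K(V)`: the abelian group generated by the isomorphism classes of quasi-projective varieties
over `ℂ` modulo the scissor relations, with the product induced by the Cartesian product. -/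
abbrev KV : Type 1 := FreeAbelianGroup IsoClass ⧸ scissorIdeal

/-- The class `[X]` of `X` in `K(V)`. -/
noncomputable def cls (X : Variety) : KV := Ideal.Quotient.mk scissorIdeal (gen X)

/-- The affine line `𝔸`, as the complement of a point in `ℙ¹`. -/
noncomputable abbrev affineLine : Variety where
  ι := Fin 2
  carrier := {p | p.rep 0 ≠ 0}
  locallyClosed := by
    have h : IsZariskiClosed {p : ProjSpace (Fin 2) | p.rep 0 = 0} :=
      ⟨{X 0}, by simpa using ⟨1, isHomogeneous_X ℂ _⟩, by simp⟩
    exact h.compl_locallyClosed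

/-! ### The space of maps -/

/-- The values at `v = (s, t)` of the `r + 1` binary forms `∑ₖ c (i, k) sᵏ tᵈ⁻ᵏ` of degree `d`. -/
noncomputable def formValues {r d : ℕ} (c : Fin (r + 1) × Fin (d + 1) → ℂ) (v : Fin 2 → ℂ) :
    Fin (r + 1) → ℂ :=
  fun i => ∑ k : Fin (d + 1), c (i, k) * v 0 ^ (k : ℕ) * v 1 ^ (d - k)

/-- The dehomogenization of the linear combination, with coefficients `a`, of the `r + 1` binary
forms with coefficients `c`. -/
noncomputable def comb {R : Type} [CommRing R] {r d : ℕ} (c : Fin (r + 1) × Fin (d + 1) → R)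
    (a : Fin (r + 1) → R) : Polynomial R :=
  ∑ k : Fin (d + 1), Polynomial.C (∑ i, a i * c (i, k)) * Polynomial.X ^ (k : ℕ)

theorem coeff_comb {R : Type} [CommRing R] {r d : ℕ} (c : Fin (r + 1) × Fin (d + 1) → R)
    (a : Fin (r + 1) → R) (n : ℕ) :
    (comb c a).coeff n = if h : n < d + 1 then ∑ i, a i * c (i, ⟨n, h⟩) else 0 := by
  simp only [comb, Polynomial.finsetSum_coeff, Polynomial.coeff_C_mul, Polynomial.coeff_X_pow]
  split_ifs with h
  · rw [Finset.sum_eq_single ⟨n, h⟩]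
    · simp
    · intro k _ hk
      have : n ≠ k := fun h' => hk (Fin.ext h'.symm)
      simp [this]
    · simp
  · refine Finset.sum_eq_zero fun k _ => ?_
    have : n ≠ k := by omega
    simp [this]

theorem natDegree_comb {R : Type} [CommRing R] {r d : ℕ} (c : Fin (r + 1) × Fin (d + 1) → R)
    (a : Fin (r + 1) → R) : (comb c a).natDegree ≤ d := by
  refine Polynomial.natDegree_le_iff_coeff_eq_zero.2 fun n hn => ?_
  rw [coeff_comb, dif_neg (by omega)]

theorem map_comb {R S : Type} [CommRing R] [CommRing S] {r d : ℕ} (φ : R →+* S)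
    (c : Fin (r + 1) × Fin (d + 1) → R) (a : Fin (r + 1) → R) :
    (comb c a).map φ = comb (φ ∘ c) (φ ∘ a) := by
  simp [comb, Polynomial.map_sum]

theorem eval_comb {r d : ℕ} (c : Fin (r + 1) × Fin (d + 1) → ℂ) (a : Fin (r + 1) → ℂ) (t : ℂ) :
    (comb c a).eval t = ∑ i, a i * formValues c ![t, 1] i := by
  simp only [comb, Polynomial.eval_finsetSum, formValues, Finset.mul_sum, Polynomial.eval_mul,
    Polynomial.eval_C, Polynomial.eval_pow, Polynomial.eval_X, Finset.sum_mul]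
  rw [Finset.sum_comm]
  simp [mul_assoc]

theorem formValues_smul {r d : ℕ} (c : Fin (r + 1) × Fin (d + 1) → ℂ) (a : ℂ) (v : Fin 2 → ℂ) :
    formValues c (a • v) = a ^ d • formValues c v := by
  ext i
  simp only [formValues, Pi.smul_apply, smul_eq_mul, Finset.mul_sum]
  refine Finset.sum_congr rfl fun k _ => ?_
  have : a ^ d = a ^ (k : ℕ) * a ^ (d - k) := by rw [← pow_add]; congr 1; omega
  rw [this]
  ring

theorem isHomogeneous_det {ι : Type} {n : ℕ} (M : Matrix (Fin n) (Fin n) (MvPolynomial ι ℂ))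
    (hM : ∀ i j, (M i j).IsHomogeneous 1) : M.det.IsHomogeneous n := by
  rw [Matrix.det_apply']
  refine IsHomogeneous.sum _ _ _ fun σ _ => ?_
  have h1 := IsHomogeneous.prod Finset.univ (fun i => M (σ i) i) (fun _ => 1) fun i _ => hM _ _
  have h2 : ((Equiv.Perm.sign σ : ℤ) : MvPolynomial ι ℂ).IsHomogeneous 0 := by
    rw [← map_intCast (C (σ := ι) (R := ℂ))]
    exact isHomogeneous_C _ _
  simpa using h2.mul h1

/-- The resultant of two linear combinations of `r + 1` generic binary forms of degree `d`. -/
noncomputable def resultantPoly (r d : ℕ) (a b : Fin (r + 1) → ℂ) :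
    MvPolynomial (Fin (r + 1) × Fin (d + 1)) ℂ :=
  Polynomial.resultant (comb X (C ∘ a)) (comb X (C ∘ b)) d d

theorem isHomogeneous_resultantPoly (r d : ℕ) (a b : Fin (r + 1) → ℂ) :
    (resultantPoly r d a b).IsHomogeneous (d + d) := by
  have hc : ∀ (a : Fin (r + 1) → ℂ) (n : ℕ),
      ((comb (X : Fin (r + 1) × Fin (d + 1) → MvPolynomial _ ℂ) (C ∘ a)).coeff
        n).IsHomogeneous 1 := by
    intro a n
    rw [coeff_comb]
    split_ifs
    · exact IsHomogeneous.sum _ _ _ fun i _ => isHomogeneous_C_mul_X _ _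
    · exact isHomogeneous_zero _ _ _
  refine isHomogeneous_det _ fun i j => ?_
  simp only [Polynomial.sylvester, Matrix.of_apply]
  refine Fin.addCases (fun j => ?_) (fun j => ?_) j
  · simp only [Fin.addCases_left]
    split_ifs
    · exact hc _ _
    · exact isHomogeneous_zero _ _ _
  · simp only [Fin.addCases_right]
    split_ifs
    · exact hc _ _
    · exact isHomogeneous_zero _ _ _

theorem eval_resultantPoly {r d : ℕ} (a b : Fin (r + 1) → ℂ)
    (c : Fin (r + 1) × Fin (d + 1) → ℂ) :
    eval c (resultantPoly r d a b) = Polynomial.resultant (comb c a) (comb c b) d d := by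
  have h : ∀ a : Fin (r + 1) → ℂ, (comb (X : _ → MvPolynomial _ ℂ) (C ∘ a)).map (eval c) =
      comb c a := by
    intro a
    rw [map_comb]
    congr 1
    · ext ik
      simp
    · ext i
      simp
  rw [resultantPoly, ← Polynomial.resultant_map_map, h, h]

theorem coprime_iff {r d : ℕ} (c : Fin (r + 1) × Fin (d + 1) → ℂ) (hc : c ≠ 0) :
    (∀ v : Fin 2 → ℂ, v ≠ 0 → formValues c v ≠ 0) ↔
      ∃ a b, Polynomial.resultant (comb c a) (comb c b) d d ≠ 0 := by
  have hv : (![1, 0] : Fin 2 → ℂ) ≠ 0 := Function.ne_iff.2 ⟨0, by simp⟩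
  have hlast : ∀ i, formValues c ![1, 0] i = c (i, Fin.last d) := by
    intro i
    simp only [formValues]
    rw [Finset.sum_eq_single (Fin.last d)]
    · simp
    · intro k _ hk
      have : d - (k : ℕ) ≠ 0 := by
        have := Fin.val_lt_last hk
        omega
      simp [this]
    · simp
  constructor
  · intro h
    obtain ⟨i, hi⟩ := Function.ne_iff.1 (h _ hv)
    rw [hlast, Pi.zero_apply] at hi
    set g := comb c (Pi.single i 1) with hg
    have hgd : g.coeff d = c (i, Fin.last d) := by
      rw [hg, coeff_comb, dif_pos (by omega), Finset.sum_eq_single i]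
      · simp [Fin.last]
      · intro j _ hj
        simp [hj]
      · simp
    have hdeg : g.natDegree = d :=
      le_antisymm (natDegree_comb _ _) (Polynomial.le_natDegree_of_ne_zero (hgd ▸ hi))
    have hg0 : g ≠ 0 := fun h0 => hi (by rw [← hgd, h0, Polynomial.coeff_zero])
    let p : g.roots.toFinset → Submodule ℂ (Fin (r + 1) → ℂ) := fun t =>
      { carrier := {a | ∑ i, a i * formValues c ![(t : ℂ), 1] i = 0}
        zero_mem' := by simp
        add_mem' := by
          intro a b ha hb
          simp only [Set.mem_ofPred_eq] at *
          simp [add_mul, Finset.sum_add_distrib, ha, hb]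
        smul_mem' := by
          intro s a ha
          simp only [Set.mem_ofPred_eq] at *
          simp [mul_assoc, ← Finset.mul_sum, ha] }
    have hp : ∀ t, p t ≠ ⊤ := by
      intro t ht
      obtain ⟨j, hj⟩ := Function.ne_iff.1 (h ![(t : ℂ), 1] (Function.ne_iff.2 ⟨1, by simp⟩))
      have : (Pi.single j 1 : Fin (r + 1) → ℂ) ∈ p t := by rw [ht]; trivial
      have : ∑ i, (Pi.single j 1 : Fin (r + 1) → ℂ) i * formValues c ![(t : ℂ), 1] i = 0 := this
      rw [Finset.sum_eq_single j (by intro k _ hk; simp [hk]) (by simp)] at this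
      exact hj (by simpa using this)
    obtain ⟨a, ha⟩ : ∃ a, ∀ t, a ∉ p t := by
      by_contra! hcon
      obtain ⟨t, ht⟩ := Subspace.exists_eq_top_of_iUnion_eq_univ (p := p)
        (Set.eq_univ_of_forall fun a => Set.mem_iUnion.2 (hcon a))
      exact hp t ht
    refine ⟨Pi.single i 1, a, ?_⟩
    have := Polynomial.resultant_eq_prod_eval g (comb c a) d (natDegree_comb _ _)
      (IsAlgClosed.splits g)
    rw [hdeg] at this
    rw [← hg, this]
    refine mul_ne_zero (pow_ne_zero _ (Polynomial.leadingCoeff_ne_zero.2 hg0))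
      (Multiset.prod_ne_zero ?_)
    intro hmem
    obtain ⟨t, ht, ht0⟩ := Multiset.mem_map.1 hmem
    rw [eval_comb] at ht0
    exact ha ⟨t, Multiset.mem_toFinset.2 ht⟩ ht0
  · rintro ⟨a, b, hab⟩ v hv0 hv
    apply hab
    rcases Nat.eq_zero_or_pos d with rfl | hd
    · refine absurd (_root_.funext fun ik => ?_) hc
      obtain ⟨i, k⟩ := ik
      rw [Subsingleton.elim (α := Fin 1) k 0]
      simpa [formValues] using congrFun hv i
    · by_cases h1 : v 1 = 0
      · have h0 : v 0 ≠ 0 := fun h0 => hv0 <| _root_.funext fun i => by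
          fin_cases i
          · exact h0
          · exact h1
        have hv' : v = v 0 • ![1, 0] := by
          ext i
          fin_cases i
          · simp
          · simpa using h1
        rw [hv', formValues_smul] at hv
        have hz : ∀ i, c (i, Fin.last d) = 0 := fun i => by
          have := congrFun hv i
          rw [Pi.smul_apply, hlast, smul_eq_mul] at this
          exact (mul_eq_zero.1 this).resolve_left (pow_ne_zero _ h0)
        have hlt : ∀ a, (comb c a).natDegree < d := by
          intro a
          refine lt_of_le_of_ne (natDegree_comb _ _) fun h => ?_
          have h2 : (comb c a).coeff d = 0 := by
            rw [coeff_comb, dif_pos (by omega)]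
            exact Finset.sum_eq_zero fun i _ => mul_eq_zero_of_right _ (hz i)
          have h3 : comb c a = 0 := by
            rw [← Polynomial.leadingCoeff_eq_zero, Polynomial.leadingCoeff, h, h2]
          rw [h3, Polynomial.natDegree_zero] at h
          omega
        exact Polynomial.resultant_eq_zero_of_lt_lt _ _ _ _ (hlt a) (hlt b)
      · have hv' : v = v 1 • ![v 0 / v 1, 1] := by
          ext i
          fin_cases i
          · simp [mul_div_cancel₀, h1]
          · simp
        rw [hv', formValues_smul] at hv
        have hz := (smul_eq_zero.1 hv).resolve_left (pow_ne_zero _ h1)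
        obtain ⟨p, q, -, -, h⟩ := Polynomial.exists_mul_add_mul_eq_C_resultant (comb c a) (comb c b)
          (natDegree_comb _ _) (natDegree_comb _ _) (Or.inl hd.ne')
        have := congrArg (Polynomial.eval (v 0 / v 1)) h
        simpa [eval_comb, hz] using this.symm

theorem isZariskiLocallyClosed_coprime (r d : ℕ) : IsZariskiLocallyClosed
    {p : ProjSpace (Fin (r + 1) × Fin (d + 1)) |
      ∀ v : Fin 2 → ℂ, v ≠ 0 → formValues p.rep v ≠ 0} := by
  have h : IsZariskiClosed {p : ProjSpace (Fin (r + 1) × Fin (d + 1)) |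
      ∀ a b, eval p.rep (resultantPoly r d a b) = 0} := by
    refine ⟨{f | ∃ a b, f = resultantPoly r d a b}, ?_, ?_⟩
    · rintro _ ⟨a, b, rfl⟩
      exact ⟨_, isHomogeneous_resultantPoly r d a b⟩
    · ext p
      constructor
      · rintro hp _ ⟨a, b, rfl⟩
        exact hp a b
      · intro hp a b
        exact hp _ ⟨a, b, rfl⟩
  convert h.compl_locallyClosed using 1
  ext p
  rw [Set.mem_ofPred_eq, coprime_iff _ p.rep_nonzero, Set.mem_compl_iff, Set.mem_ofPred_eq]
  simp only [eval_resultantPoly, not_forall]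

/-- The variety `Map(r, d)` of algebraic maps of degree `d` from `ℙ¹` to `ℙʳ`: its points are the
sequences `[f₀ : ⋯ : fᵣ]` of binary forms of degree `d` without common zero, up to a common
scalar. It is open in the projective space of the coefficients. -/
noncomputable abbrev mapVariety (r d : ℕ) : Variety where
  ι := Fin (r + 1) × Fin (d + 1)
  carrier := {p | ∀ v : Fin 2 → ℂ, v ≠ 0 → formValues p.rep v ≠ 0}
  locallyClosed := isZariskiLocallyClosed_coprime r d

/-- The map `ℙ¹ → ℙʳ`, `q ↦ [f₀(q) : ⋯ : fᵣ(q)]`, attached to a point `[f₀ : ⋯ : fᵣ]` of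
`Map(r, d)`. -/
noncomputable def mapEval (r d : ℕ) (p : (mapVariety r d).carrier) (q : (projSpace 1).carrier) :
    (projSpace r).carrier :=
  ⟨Projectivization.mk ℂ (formValues p.1.rep q.1.rep) (p.2 _ q.1.rep_nonzero), trivial⟩

/-- `φ : ℙ¹ → ℙʳ` is an algebraic map of degree `d`, i.e. with `φ^* O(1) = O(d)`: it is given by
`r + 1` sections of `O(d)` without common zero. -/
def IsMapOfDegree {r : ℕ} (d : ℕ) (φ : (projSpace 1).carrier → (projSpace r).carrier) : Prop :=
  ∃ F : Fin (r + 1) → MvPolynomial (Fin 2) ℂ, (∀ i, (F i).IsHomogeneous d) ∧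
    ∀ q : (projSpace 1).carrier, ∃ h : (fun i => eval q.1.rep (F i)) ≠ 0,
      (φ q).1 = Projectivization.mk ℂ (fun i => eval q.1.rep (F i)) h

/-- An algebraic family, parametrized by the variety `T`, of maps of degree `d` from `ℙ¹` to
`ℙʳ`: a regular map `T × ℙ¹ → ℙʳ` that has degree `d` on every fibre `{t} × ℙ¹`. -/
structure IsMapFamily {r : ℕ} (d : ℕ) (T : Variety)
    (Φ : T.carrier → (projSpace 1).carrier → (projSpace r).carrier) : Prop where
  regular : IsRegular (X := T.prod (projSpace 1)) (Y := projSpace r)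
    (fun z => Φ ((T.prodEquiv (projSpace 1)).symm z).1 ((T.prodEquiv (projSpace 1)).symm z).2)
  degree : ∀ t, IsMapOfDegree d (Φ t)

/-- `M`, with the family `ev`, is the (fine moduli) space of maps of degree `d` from `ℙ¹` to
`ℙʳ`: every family of such maps over a variety `T` is the pullback of `ev` along a unique regular
map `T → M`. -/
structure IsMapSpace {r : ℕ} (d : ℕ) (M : Variety)
    (ev : M.carrier → (projSpace 1).carrier → (projSpace r).carrier) : Prop where
  family : IsMapFamily d M ev
  universal : ∀ (T : Variety) (Φ : T.carrier → (projSpace 1).carrier → (projSpace r).carrier),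
    IsMapFamily d T Φ → ∃! g : T.carrier → M.carrier, IsRegular g ∧ ∀ t, Φ t = ev (g t)

end QuasiProj

open QuasiProj

/-!
The space `Map(r, d)` and its class are studied through homogeneous systems of linear equations
whose coefficients are polynomials in the coordinates of a point. If such a system has a single
solution up to scalars, the solution is a regular function of the point, by Cramer's rule
(`isRegularAt_of_kernel`); and the points where it has a nonzero solution form a closed set
(`isZariskiClosed_exists_ne_zero`).

*Moduli property.* Binary forms `f` of degree `d` without common zero are determined up to a
scalar by the values of the map `[f₀ : ⋯ : fᵣ]` at `2 d + 1` points: if `q` takes proportional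
values there, then `fᵢ qⱼ - fⱼ qᵢ`, of degree `2 d`, vanishes, and a Bézout relation between the
`fᵢ` shows that `q` is a multiple of `f`. For a family of maps over `T` the values at these points
are regular functions of `t ∈ T`, so that the coefficients of `f` are the solution of a linear
system as above (`IsMapFamily.isRegular`).

*The class.* Every nonzero sequence `F` of `r + 1` forms of degree `d` is, uniquely up to scalars,
the product of a sequence of forms of some degree `e` without common zero and a form of degree
`k = d - e`. The sequences `q` with `Fᵢ qⱼ = Fⱼ qᵢ` are the multiples of the first factor. Hence the
condition that such a `q` exists in degree at most `e` is closed, and defines a stratification of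
the projective space of all `F`; the strata are isomorphic to `Map(r, e) × ℙᵏ`, because the two
factors of `F` solve a linear system with coefficients depending on `F` (`stratum_iso`). Therefore
`∑_{e + k = d} [Map(r, e)] [ℙᵏ] = [ℙ^{(r + 1)(d + 1) - 1}]`. As `[ℙⁿ] = 1 + [𝔸] + ⋯ + [𝔸]ⁿ`, these
relations for all `d` say that
`∑ qᵈ [Map(r, d)] / ((1 - q) (1 - q [𝔸])) = [ℙʳ] / ((1 - q) (1 - q [𝔸]ʳ⁺¹))`,
which gives the generating series (`mk_cls_mapVariety`) and, by comparing coefficients, the formula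
for `[Map(r, d)]`.
-/

namespace QuasiProj

open MvPolynomial

/-! ### Linear systems with polynomial coefficients -/

theorem isHomogeneous_det_of_isHomogeneous {ι κ : Type} [Fintype κ] [DecidableEq κ] {n : ℕ}
    (M : Matrix κ κ (MvPolynomial ι ℂ)) (hM : ∀ i j, (M i j).IsHomogeneous n) :
    M.det.IsHomogeneous (Fintype.card κ * n) := by
  rw [Matrix.det_apply']
  refine IsHomogeneous.sum _ _ _ fun σ _ => ?_
  have h1 := IsHomogeneous.prod Finset.univ (fun i => M (σ i) i) (fun _ => n) fun i _ => hM _ _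
  have h2 : ((Equiv.Perm.sign σ : ℤ) : MvPolynomial ι ℂ).IsHomogeneous 0 := by
    rw [← map_intCast (C (σ := ι) (R := ℂ))]
    exact isHomogeneous_C _ _
  simpa using h2.mul h1

section Pencil

variable {ι τ κ E : Type} [Fintype τ] [DecidableEq τ] [DecidableEq κ]
  [AddCommGroup E] [Module ℂ E]

/-- The square matrix of the endomorphisms `v ↦ A (β (W y) v)` of `ℂ^κ`, depending polynomially
on `y`. -/
noncomputable def pencil (β : (τ → ℂ) →ₗ[ℂ] (κ → ℂ) →ₗ[ℂ] E) (A : E →ₗ[ℂ] κ → ℂ)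
    (W : τ → MvPolynomial ι ℂ) : Matrix κ κ (MvPolynomial ι ℂ) :=
  Matrix.of fun i j => ∑ s, C (A (β (Pi.single s 1) (Pi.single j 1)) i) * W s

theorem isHomogeneous_pencil (β : (τ → ℂ) →ₗ[ℂ] (κ → ℂ) →ₗ[ℂ] E) (A : E →ₗ[ℂ] κ → ℂ)
    {W : τ → MvPolynomial ι ℂ} {n : ℕ} (hW : ∀ s, (W s).IsHomogeneous n) (i j : κ) :
    (pencil β A W i j).IsHomogeneous n :=
  IsHomogeneous.sum _ _ _ fun s _ => by simpa using (isHomogeneous_C ι _).mul (hW s)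

variable [Fintype κ]

theorem pencil_mulVec (β : (τ → ℂ) →ₗ[ℂ] (κ → ℂ) →ₗ[ℂ] E) (A : E →ₗ[ℂ] κ → ℂ)
    (W : τ → MvPolynomial ι ℂ) (y : ι → ℂ) (v : κ → ℂ) :
    ((pencil β A W).map (eval y)).mulVec v = A (β (fun s => eval y (W s)) v) := by
  have h : (pencil β A W).map (eval y) =
      LinearMap.toMatrix' (A ∘ₗ β (fun s => eval y (W s))) := by
    ext i j
    have h1 : (fun s => eval y (W s)) = ∑ s, eval y (W s) • (Pi.single s 1 : τ → ℂ) := by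
      simpa using pi_eq_sum_univ' (fun s => eval y (W s))
    rw [LinearMap.toMatrix'_apply, h1]
    simp [pencil, mul_comm]
  rw [h, LinearMap.toMatrix'_mulVec]
  rfl

/-- The determinant of the pencil does not vanish at `y` exactly when `A` composed with the system
of equations at `y` is injective. -/
theorem eval_det_pencil_ne_zero (β : (τ → ℂ) →ₗ[ℂ] (κ → ℂ) →ₗ[ℂ] E) (A : E →ₗ[ℂ] κ → ℂ)
    (W : τ → MvPolynomial ι ℂ) (y : ι → ℂ) :
    eval y (pencil β A W).det ≠ 0 ↔ ∀ v, A (β (fun s => eval y (W s)) v) = 0 → v = 0 := by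
  rw [RingHom.map_det, RingHom.mapMatrix_apply, ← isUnit_iff_ne_zero,
    ← Matrix.isUnit_iff_isUnit_det, ← Matrix.mulVec_injective_iff_isUnit]
  simp_rw [← pencil_mulVec]
  exact injective_iff_map_eq_zero ((pencil β A W).map (eval y)).mulVecLin

/-- For a system without nonzero solution at `y`, a left inverse serves as `A`. -/
theorem exists_eval_det_pencil_ne_zero (β : (τ → ℂ) →ₗ[ℂ] (κ → ℂ) →ₗ[ℂ] E)
    (W : τ → MvPolynomial ι ℂ) (y : ι → ℂ)
    (h : ∀ v, β (fun s => eval y (W s)) v = 0 → v = 0) :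
    ∃ A : E →ₗ[ℂ] κ → ℂ, eval y (pencil β A W).det ≠ 0 := by
  obtain ⟨A, hA⟩ := LinearMap.exists_leftInverse_of_injective (β fun s => eval y (W s))
    (LinearMap.ker_eq_bot'.2 h)
  refine ⟨A, (eval_det_pencil_ne_zero β A W y).2 fun v hv => ?_⟩
  simpa [hv] using (LinearMap.congr_fun hA v).symm

/-- The points where a linear system with homogeneous coefficients has a nonzero solution form a
closed set: it is defined by the determinants of all square systems deduced from it. -/
theorem isZariskiClosed_exists_ne_zero (β : (τ → ℂ) →ₗ[ℂ] (κ → ℂ) →ₗ[ℂ] E)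
    {W : τ → MvPolynomial ι ℂ} {n : ℕ} (hW : ∀ s, (W s).IsHomogeneous n) :
    IsZariskiClosed {p : ProjSpace ι | ∃ v ≠ 0, β (fun s => eval p.rep (W s)) v = 0} := by
  refine ⟨Set.range fun A => (pencil β A W).det, ?_, ?_⟩
  · rintro _ ⟨A, rfl⟩
    exact ⟨_, isHomogeneous_det_of_isHomogeneous _ (isHomogeneous_pencil β A hW)⟩
  · ext p
    simp only [Set.forall_mem_range, Set.mem_ofPred_eq]
    constructor
    · rintro ⟨v, hv, h⟩ A
      by_contra hA
      exact hv ((eval_det_pencil_ne_zero β A W _).1 hA v (by rw [h, map_zero]))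
    · intro h
      by_contra! hc
      obtain ⟨A, hA⟩ := exists_eval_det_pencil_ne_zero β W p.rep
        fun v hv => by_contra fun h0 => hc v h0 hv
      exact hA (h A)

end Pencil

/-! ### Criteria of regularity -/

/-- The map `f` is regular near the point `x`. -/
def IsRegularAt {X Y : Variety} (f : X.carrier → Y.carrier) (x : X.carrier) : Prop :=
  ∃ (n : ℕ) (F : Y.ι → MvPolynomial X.ι ℂ),
    (∀ i, (F i).IsHomogeneous n) ∧ (fun i => eval x.1.rep (F i)) ≠ 0 ∧
    ∀ (y : X.carrier) (hy : (fun i => eval y.1.rep (F i)) ≠ 0),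
      (f y).1 = Projectivization.mk ℂ (fun i => eval y.1.rep (F i)) hy

theorem mk_eq_of_smul_eq {ι : Type} (p : ProjSpace ι) (w : ι → ℂ) (hw : w ≠ 0) (a b : ℂ)
    (ha : a ≠ 0) (h : a • p.rep = b • w) : p = Projectivization.mk ℂ w hw := by
  refine (Projectivization.mk_rep p).symm.trans (mk_congr _ _ (a⁻¹ * b) ?_)
  rw [mul_smul, ← h, smul_smul, inv_mul_cancel₀ ha, one_smul]

/-- A map is regular at `x` if polynomials `F i` represent it on the open set where a further
polynomial `S` does not vanish. -/
theorem isRegularAt_of_guard {X Y : Variety} {f : X.carrier → Y.carrier} {x : X.carrier}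
    {m n : ℕ} {S : MvPolynomial X.ι ℂ} (hS : S.IsHomogeneous m) (hSx : eval x.1.rep S ≠ 0)
    {F : Y.ι → MvPolynomial X.ι ℂ} (hF : ∀ i, (F i).IsHomogeneous n)
    (h : ∀ y : X.carrier, eval y.1.rep S ≠ 0 → ∃ a b : ℂ, a ≠ 0 ∧
      a • (f y).1.rep = b • fun i => eval y.1.rep (F i)) : IsRegularAt f x := by
  have hF0 : ∀ y : X.carrier, eval y.1.rep S ≠ 0 → (fun i => eval y.1.rep (F i)) ≠ 0 := by
    intro y hy h0
    obtain ⟨a, b, ha, hab⟩ := h y hy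
    rw [h0, smul_zero] at hab
    exact smul_ne_zero ha (f y).1.rep_nonzero hab
  have hmul : ∀ y : X.carrier, (fun i => eval y.1.rep (S * F i)) =
      eval y.1.rep S • fun i => eval y.1.rep (F i) := fun y => by
    ext i
    simp
  refine ⟨m + n, fun i => S * F i, fun i => hS.mul (hF i), ?_, fun y hy => ?_⟩
  · rw [hmul]
    exact smul_ne_zero hSx (hF0 x hSx)
  · have hSy : eval y.1.rep S ≠ 0 := fun h0 => hy (by rw [hmul, h0, zero_smul])
    obtain ⟨a, b, ha, hab⟩ := h y hSy
    refine mk_eq_of_smul_eq _ _ hy a (b / eval y.1.rep S) ha ?_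
    rw [hab, hmul, smul_smul, div_mul_cancel₀ _ hSy]

/-- A map `f` is regular at `x` if `f y` is, near `x`, a solution of a homogeneous linear system
whose coefficients are polynomials in `y`, and is at `x` the only solution up to scalars. The
solution is extracted by Cramer's rule, after a normalizing equation has been added to the
system. -/
theorem isRegularAt_of_kernel {X Y : Variety} {f : X.carrier → Y.carrier} {x : X.carrier}
    {τ E : Type} [Fintype τ] [AddCommGroup E] [Module ℂ E]
    (β : (τ → ℂ) →ₗ[ℂ] (Y.ι → ℂ) →ₗ[ℂ] E)
    {m n : ℕ} {S : MvPolynomial X.ι ℂ} (hS : S.IsHomogeneous m) (hSx : eval x.1.rep S ≠ 0)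
    {W : τ → MvPolynomial X.ι ℂ} (hW : ∀ s, (W s).IsHomogeneous n)
    (hx : ∀ v, β (fun s => eval x.1.rep (W s)) v = 0 → ∃ a : ℂ, v = a • (f x).1.rep)
    (h : ∀ y : X.carrier, eval y.1.rep S ≠ 0 →
      β (fun s => eval y.1.rep (W s)) (f y).1.rep = 0) : IsRegularAt f x := by
  classical
  have := Y.finite_ι
  let _ := Fintype.ofFinite Y.ι
  obtain ⟨i₀, hi₀⟩ := Function.ne_iff.1 (f x).1.rep_nonzero
  obtain ⟨k₀, hk₀⟩ := Function.ne_iff.1 x.1.rep_nonzero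
  simp only [Pi.zero_apply] at hi₀ hk₀
  -- the system with the additional linear form `v ↦ y k₀ ^ n * v i₀`
  let β' : (Option τ → ℂ) →ₗ[ℂ] (Y.ι → ℂ) →ₗ[ℂ] ℂ × E :=
    LinearMap.mk₂ ℂ (fun w v => (w none * v i₀, β (w ∘ some) v))
      (fun w w' v => by
        have : (w + w') ∘ some = w ∘ some + w' ∘ some := rfl
        simp [this, add_mul])
      (fun c w v => by
        have : (c • w) ∘ some = c • (w ∘ some) := rfl
        simp [this, mul_assoc])
      (fun w v v' => by simp [mul_add])
      (fun c w v => by simp [mul_left_comm])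
  let W' : Option τ → MvPolynomial X.ι ℂ := fun o => o.elim (MvPolynomial.X k₀ ^ n) W
  have hW' : ∀ s, (W' s).IsHomogeneous n := by
    rintro (_ | s)
    · exact isHomogeneous_X_pow _ _
    · exact hW s
  have hβ' : ∀ (y : X.ι → ℂ) v, β' (fun s => eval y (W' s)) v =
      (y k₀ ^ n * v i₀, β (fun s => eval y (W s)) v) := by
    intro y v
    simp [β', W', Function.comp_def]
  obtain ⟨A, hA⟩ := exists_eval_det_pencil_ne_zero β' W' x.1.rep <| by
    intro v hv
    rw [hβ', Prod.mk_eq_zero] at hv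
    obtain ⟨a, rfl⟩ := hx v hv.2
    have := hv.1
    simp only [Pi.smul_apply, smul_eq_mul, mul_eq_zero, pow_eq_zero_iff', hk₀, hi₀] at this
    simp_all
  set B := pencil β' A W' with hB
  have hBhom := isHomogeneous_pencil β' A hW'
  let b : Y.ι → MvPolynomial X.ι ℂ := fun i => C (A (1, 0) i) * MvPolynomial.X k₀ ^ n
  have hcr : ∀ i, (B.cramer b i).IsHomogeneous (Fintype.card Y.ι * n) := by
    intro i
    rw [Matrix.cramer_apply]
    refine isHomogeneous_det_of_isHomogeneous _ fun j k => ?_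
    by_cases hk : k = i
    · subst hk
      rw [Matrix.updateCol_self]
      simpa using (isHomogeneous_C X.ι (A (1, 0) j)).mul (isHomogeneous_X_pow k₀ n)
    · rw [Matrix.updateCol_ne hk]
      exact hBhom j k
  refine isRegularAt_of_guard
    (hS.mul (isHomogeneous_det_of_isHomogeneous B hBhom)) (by simpa using ⟨hSx, hA⟩) hcr
    fun y hy => ?_
  rw [map_mul, mul_ne_zero_iff] at hy
  set v := (f y).1.rep with hv
  -- the normalized system at `y`, to which Cramer's rule applies
  have h1 : (B.map (eval y.1.rep)).mulVec v = v i₀ • fun i => eval y.1.rep (b i) := by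
    rw [hB, pencil_mulVec, hβ', h y hy.1]
    have : ((y.1.rep k₀ ^ n * v i₀, 0) : ℂ × E) = (y.1.rep k₀ ^ n * v i₀) • (1, 0) := by simp
    rw [this, map_smul]
    ext i
    simp [b]
    ring
  refine ⟨eval y.1.rep B.det, v i₀, hy.2, ?_⟩
  have h2 := congrArg (Matrix.mulVec (B.map (eval y.1.rep)).adjugate) h1
  rw [Matrix.mulVec_mulVec, Matrix.adjugate_mul, Matrix.smul_mulVec, Matrix.one_mulVec] at h2
  rw [RingHom.map_det, RingHom.mapMatrix_apply, h2, Matrix.mulVec_smul]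
  congr 1
  rw [← Matrix.cramer_eq_adjugate_mulVec]
  ext i
  rw [Matrix.cramer_apply, Matrix.cramer_apply, RingHom.map_det, RingHom.mapMatrix_apply]
  congr 1
  ext j k
  by_cases hk : k = i
  · subst hk
    simp
  · simp [Matrix.updateCol_ne hk]

/-! ### Sequences of polynomials in one variable -/

section Tuples

open Polynomial (ofFn)

variable {I : Type}

/-- The polynomials `∑ₖ c (i, k) tᵏ` of degree `< n` with coefficients `c`. For `n = d + 1` they
are the dehomogenizations of the binary forms of degree `d` with coefficients `c`. -/
noncomputable def tuple (n : ℕ) : (I × Fin n → ℂ) →ₗ[ℂ] I → Polynomial ℂ :=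
  LinearMap.pi fun i => ofFn n ∘ₗ LinearMap.funLeft ℂ ℂ fun k => (i, k)

theorem tuple_apply {n : ℕ} (c : I × Fin n → ℂ) (i : I) :
    tuple n c i = ofFn n fun k => c (i, k) := rfl

theorem coeff_tuple {n : ℕ} (c : I × Fin n → ℂ) (i : I) (k : Fin n) :
    (tuple n c i).coeff k = c (i, k) := by
  rw [tuple_apply, Polynomial.ofFn_coeff_eq_val_of_lt _ k.2]

theorem degree_tuple_lt {n : ℕ} (c : I × Fin n → ℂ) (i : I) : (tuple n c i).degree < n :=
  Polynomial.ofFn_degree_lt _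

theorem tuple_injective (n : ℕ) : Function.Injective (tuple (I := I) n) := by
  intro c c' h
  ext ⟨i, k⟩
  rw [← coeff_tuple c, h, coeff_tuple]

theorem exists_ofFn_eq {n : ℕ} {g : Polynomial ℂ} (hg : g.degree < n) : ∃ h, ofFn n h = g := by
  refine ⟨Polynomial.toFn n g, Polynomial.ext fun k => ?_⟩
  rcases lt_or_ge k n with hk | hk
  · rw [Polynomial.ofFn_coeff_eq_val_of_lt _ hk]
    rfl
  · rw [Polynomial.ofFn_coeff_eq_zero_of_ge _ hk, Polynomial.coeff_eq_zero_of_degree_lt]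
    exact hg.trans_le (by exact_mod_cast hk)

theorem exists_tuple_eq {n : ℕ} {P : I → Polynomial ℂ} (hP : ∀ i, (P i).degree < n) :
    ∃ c, tuple n c = P := by
  choose h hh using fun i => exists_ofFn_eq (hP i)
  exact ⟨fun ik => h ik.1 ik.2, _root_.funext hh⟩

/-- The polynomials `p i` generate the unit ideal. -/
def IsUnimodular [Fintype I] (p : I → Polynomial ℂ) : Prop :=
  ∃ a : I → Polynomial ℂ, ∑ i, a i * p i = 1

variable [Fintype I]

theorem IsUnimodular.ne_zero {p : I → Polynomial ℂ} (hp : IsUnimodular p) : p ≠ 0 := by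
  rintro rfl
  obtain ⟨a, ha⟩ := hp
  simp at ha

/-- If `p` is unimodular, the sequences proportional to `p` over the field of rational functions
are its multiples by polynomials: the factor is `∑ᵢ a i * q i` if `∑ᵢ a i * p i = 1`. -/
theorem IsUnimodular.exists_eq_smul {p q : I → Polynomial ℂ} (hp : IsUnimodular p)
    (h : ∀ i j, p i * q j = p j * q i) : ∃ g : Polynomial ℂ, q = g • p := by
  obtain ⟨a, ha⟩ := hp
  refine ⟨∑ i, a i * q i, _root_.funext fun j => ?_⟩
  rw [Pi.smul_apply, smul_eq_mul, Finset.sum_mul]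
  calc q j = (∑ i, a i * p i) * q j := by rw [ha, one_mul]
    _ = _ := by
      rw [Finset.sum_mul]
      exact Finset.sum_congr rfl fun i _ => by linear_combination a i * h i j

/-- A nonzero sequence of polynomials is the product of its greatest common divisor and a unimodular
sequence. -/
theorem exists_eq_smul_isUnimodular {F : I → Polynomial ℂ} (hF : F ≠ 0) :
    ∃ (h : Polynomial ℂ) (p : I → Polynomial ℂ), h ≠ 0 ∧ IsUnimodular p ∧ F = h • p := by
  obtain ⟨h, hh⟩ := (IsPrincipalIdealRing.principal (Ideal.span (Set.range F))).principal
  have hd : ∀ i, h ∣ F i := fun i => by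
    rw [← Ideal.mem_span_singleton]
    exact (SetLike.ext_iff.1 hh (F i)).1 (Ideal.subset_span ⟨i, rfl⟩)
  choose p hp using hd
  have h0 : h ≠ 0 := by
    rintro rfl
    exact hF (_root_.funext fun i => by simp [hp i])
  have hm : h ∈ Ideal.span (Set.range F) := by
    rw [hh]
    exact Ideal.mem_span_singleton_self h
  obtain ⟨a, ha⟩ := (Ideal.mem_span_range_iff_exists_fun).1 hm
  refine ⟨h, p, h0, ⟨a, mul_left_cancel₀ h0 ?_⟩, _root_.funext hp⟩
  rw [mul_one, Finset.mul_sum]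
  refine Eq.trans (Finset.sum_congr rfl fun i _ => ?_) ha
  rw [hp i]
  ring

/-- Polynomials over `ℂ` generate the unit ideal if and only if they have no common root. -/
theorem isUnimodular_iff {p : I → Polynomial ℂ} :
    IsUnimodular p ↔ ∀ t : ℂ, ∃ i, (p i).eval t ≠ 0 := by
  constructor
  · rintro ⟨a, ha⟩ t
    by_contra! h
    have := congrArg (Polynomial.eval t) ha
    simp [Polynomial.eval_finsetSum, h] at this
  · intro h
    have hp : p ≠ 0 := by
      rintro rfl
      simpa using h 0
    obtain ⟨g, q, hg, ⟨a, ha⟩, rfl⟩ := exists_eq_smul_isUnimodular hp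
    have hdeg : g.degree = 0 := by
      by_contra hd
      obtain ⟨t, ht⟩ := IsAlgClosed.exists_root g hd
      obtain ⟨i, hi⟩ := h t
      exact hi (by simp [ht.eq_zero])
    obtain ⟨u, hu⟩ := (Polynomial.isUnit_iff_degree_eq_zero.2 hdeg).exists_left_inv
    refine ⟨fun i => u * a i, ?_⟩
    rw [← ha]
    refine Finset.sum_congr rfl fun i _ => ?_
    rw [Pi.smul_apply, smul_eq_mul]
    linear_combination a i * q i * hu

end Tuples

/-! ### Binary forms without common zero -/

section Forms

open Polynomial (ofFn)

variable {r d : ℕ}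

theorem formValues_eq_eval_tuple (c : Fin (r + 1) × Fin (d + 1) → ℂ) (t : ℂ) (i : Fin (r + 1)) :
    formValues c ![t, 1] i = (tuple (d + 1) c i).eval t := by
  rw [tuple_apply, Polynomial.ofFn_eq_sum_monomial]
  simp [formValues, Polynomial.eval_finsetSum, Polynomial.eval_monomial]

theorem formValues_one_zero (c : Fin (r + 1) × Fin (d + 1) → ℂ) (i : Fin (r + 1)) :
    formValues c ![1, 0] i = c (i, Fin.last d) := by
  simp only [formValues]
  rw [Finset.sum_eq_single (Fin.last d)]
  · simp
  · intro k _ hk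
    have : d - (k : ℕ) ≠ 0 := by
      have := Fin.val_lt_last hk
      omega
    simp [this]
  · simp

theorem exists_eq_smul_of_ne_zero {v : Fin 2 → ℂ} (hv : v ≠ 0) :
    ∃ a : ℂ, a ≠ 0 ∧ ((∃ t : ℂ, v = a • ![t, 1]) ∨ v = a • ![1, 0]) := by
  by_cases h1 : v 1 = 0
  · refine ⟨v 0, fun h0 => hv ?_, Or.inr ?_⟩
    · ext i
      fin_cases i
      · exact h0
      · exact h1
    · ext i
      fin_cases i
      · simp
      · simpa using h1
  · refine ⟨v 1, h1, Or.inl ⟨v 0 / v 1, ?_⟩⟩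
    ext i
    fin_cases i
    · simp [mul_div_cancel₀, h1]
    · simp

/-- The binary forms of degree `d` with coefficients `c` have no common zero on `ℙ¹`. -/
def AreCoprime (c : Fin (r + 1) × Fin (d + 1) → ℂ) : Prop :=
  ∀ v : Fin 2 → ℂ, v ≠ 0 → formValues c v ≠ 0

/-- Binary forms have no common zero if their dehomogenizations generate the unit ideal, and they
do not all vanish at infinity. -/
theorem areCoprime_iff (c : Fin (r + 1) × Fin (d + 1) → ℂ) :
    AreCoprime c ↔ IsUnimodular (tuple (d + 1) c) ∧ ∃ i, c (i, Fin.last d) ≠ 0 := by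
  rw [isUnimodular_iff]
  constructor
  · refine fun h => ⟨fun t => ?_, ?_⟩
    · obtain ⟨i, hi⟩ := Function.ne_iff.1 (h ![t, 1] (Function.ne_iff.2 ⟨1, by simp⟩))
      exact ⟨i, by rwa [← formValues_eq_eval_tuple]⟩
    · obtain ⟨i, hi⟩ := Function.ne_iff.1 (h ![1, 0] (Function.ne_iff.2 ⟨0, by simp⟩))
      exact ⟨i, by rwa [← formValues_one_zero c]⟩
  · rintro ⟨h, i, hi⟩ v hv
    obtain ⟨a, ha, ⟨t, rfl⟩ | rfl⟩ := exists_eq_smul_of_ne_zero hv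
    · obtain ⟨j, hj⟩ := h t
      rw [formValues_smul]
      refine smul_ne_zero (pow_ne_zero _ ha) (Function.ne_iff.2 ⟨j, ?_⟩)
      rwa [formValues_eq_eval_tuple]
    · rw [formValues_smul]
      refine smul_ne_zero (pow_ne_zero _ ha) (Function.ne_iff.2 ⟨i, ?_⟩)
      rwa [formValues_one_zero]

theorem formValues_smul_left (a : ℂ) (c : Fin (r + 1) × Fin (d + 1) → ℂ) (v : Fin 2 → ℂ) :
    formValues (a • c) v = a • formValues c v := by
  ext i
  simp [formValues, Finset.mul_sum, mul_assoc]

theorem AreCoprime.smul {c : Fin (r + 1) × Fin (d + 1) → ℂ} (hc : AreCoprime c) {a : ℂ}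
    (ha : a ≠ 0) : AreCoprime (a • c) := fun v hv => by
  rw [formValues_smul_left]
  exact smul_ne_zero ha (hc v hv)

theorem AreCoprime.ne_zero {c : Fin (r + 1) × Fin (d + 1) → ℂ} (hc : AreCoprime c) : c ≠ 0 := by
  rintro rfl
  obtain ⟨-, i, hi⟩ := (areCoprime_iff _).1 hc
  exact hi rfl

/-- Since one of the coprime forms `c` of degree `d` has a nonzero coefficient of `tᵈ`, the factor
`g` in a multiple of `c` of bounded degree has degree smaller by `d`. -/
theorem AreCoprime.degree_lt {c : Fin (r + 1) × Fin (d + 1) → ℂ} (hc : AreCoprime c)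
    {g : Polynomial ℂ} {m n : ℕ} (hm : m = n + d)
    (h : ∀ i, (g * tuple (d + 1) c i).degree < (m : ℕ)) : g.degree < n := by
  obtain ⟨-, i, hi⟩ := (areCoprime_iff _).1 hc
  by_contra! hg
  rw [← coeff_tuple c] at hi
  have h1 : ((d : ℕ) : WithBot ℕ) ≤ (tuple (d + 1) c i).degree :=
    Polynomial.le_degree_of_ne_zero hi
  have h2 := h i
  rw [Polynomial.degree_mul, hm, Nat.cast_add] at h2
  exact absurd (add_le_add hg h1) (not_le.2 h2)

/-- Among the sequences of polynomials of degree at most `d`, the multiples by a scalar of a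
sequence `c` of forms of degree `d` without common zero are those proportional to `c` as sequences
of rational functions. -/
theorem AreCoprime.exists_eq_smul {c q : Fin (r + 1) × Fin (d + 1) → ℂ} (hc : AreCoprime c)
    (h : ∀ i j, tuple (d + 1) c i * tuple (d + 1) q j = tuple (d + 1) c j * tuple (d + 1) q i) :
    ∃ a : ℂ, q = a • c := by
  obtain ⟨g, hg⟩ := ((areCoprime_iff c).1 hc).1.exists_eq_smul h
  have hdeg : g.degree < (1 : ℕ) := hc.degree_lt (Nat.add_comm d 1) fun i => by
    have := degree_tuple_lt q i
    rwa [hg] at this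
  have hC := Polynomial.eq_C_of_degree_le_zero (p := g) <| by
    rw [← Polynomial.natDegree_eq_zero_iff_degree_le_zero]
    rcases eq_or_ne g 0 with rfl | h0
    · simp
    · rw [Polynomial.degree_eq_natDegree h0] at hdeg
      have : g.natDegree < 1 := by exact_mod_cast hdeg
      omega
  refine ⟨g.coeff 0, tuple_injective _ ?_⟩
  rw [map_smul, hg]
  ext i : 1
  rw [Pi.smul_apply, Pi.smul_apply, smul_eq_mul]
  conv_lhs => rw [hC]
  rw [Polynomial.C_mul']

/-- The relations `F i * q j = F j * q i` expressing that two sequences of forms are proportional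
as sequences of rational functions, as a bilinear system of equations. -/
noncomputable def cross (n m : ℕ) : (Fin (r + 1) × Fin n → ℂ) →ₗ[ℂ]
    (Fin (r + 1) × Fin m → ℂ) →ₗ[ℂ] Fin (r + 1) → Fin (r + 1) → Polynomial ℂ :=
  LinearMap.mk₂ ℂ (fun F q i j => tuple n F i * tuple m q j - tuple n F j * tuple m q i)
    (fun F F' q => by ext1 i; ext1 j; simp only [map_add, Pi.add_apply]; ring)
    (fun a F q => by
      ext1 i; ext1 j
      simp only [map_smul, Pi.smul_apply, Polynomial.smul_eq_C_mul]; ring)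
    (fun F q q' => by ext1 i; ext1 j; simp only [map_add, Pi.add_apply]; ring)
    (fun a F q => by
      ext1 i; ext1 j
      simp only [map_smul, Pi.smul_apply, Polynomial.smul_eq_C_mul]; ring)

theorem cross_eq_zero_iff {n m : ℕ} {F : Fin (r + 1) × Fin n → ℂ} {q : Fin (r + 1) × Fin m → ℂ} :
    cross n m F q = 0 ↔ ∀ i j, tuple n F i * tuple m q j = tuple n F j * tuple m q i := by
  simp only [_root_.funext_iff, cross, LinearMap.mk₂_apply, Pi.zero_apply, sub_eq_zero]

/-- If `F` is a multiple of a unimodular sequence `p`, the sequences proportional to `F` are the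
multiples of `p`. -/
theorem cross_eq_zero_iff_of_eq_smul {n m : ℕ} {F : Fin (r + 1) × Fin n → ℂ}
    {q : Fin (r + 1) × Fin m → ℂ} {h : Polynomial ℂ} {p : Fin (r + 1) → Polynomial ℂ}
    (hh : h ≠ 0) (hp : IsUnimodular p) (hF : tuple n F = h • p) :
    cross n m F q = 0 ↔ ∃ g : Polynomial ℂ, tuple m q = g • p := by
  rw [cross_eq_zero_iff, hF]
  constructor
  · refine fun H => hp.exists_eq_smul fun i j => mul_left_cancel₀ hh ?_
    simpa [mul_assoc] using H i j
  · rintro ⟨g, hg⟩ i j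
    rw [hg]
    simp only [Pi.smul_apply, smul_eq_mul]
    ring

/-- The greatest common divisor of the forms `F` of degree `e + k` has degree `k` exactly when the
smallest degree of a sequence of forms proportional to `F` is `e`. -/
theorem exists_cross_eq_zero_iff {e k : ℕ} {F : Fin (r + 1) × Fin (e + k + 1) → ℂ} (hF : F ≠ 0) :
    ((∃ q ≠ 0, cross _ (e + 1) F q = 0) ∧ ¬ ∃ q ≠ 0, cross _ e F q = 0) ↔
      ∃ (c : Fin (r + 1) × Fin (e + 1) → ℂ) (h : Fin (k + 1) → ℂ), AreCoprime c ∧ h ≠ 0 ∧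
        tuple _ F = ofFn _ h • tuple _ c := by
  constructor
  · rintro ⟨⟨q, hq0, hq⟩, hn⟩
    obtain ⟨h, p, hh, hp, hFp⟩ := exists_eq_smul_isUnimodular
      (fun h0 => hF (tuple_injective _ (h0.trans (map_zero _).symm)) : tuple _ F ≠ 0)
    obtain ⟨g, hg⟩ := (cross_eq_zero_iff_of_eq_smul hh hp hFp).1 hq
    have hg0 : g ≠ 0 := by
      rintro rfl
      exact hq0 (tuple_injective _ (by simpa using hg))
    have hpe : ∀ i, (p i).degree < (e + 1 : ℕ) := fun i => by
      have h1 := degree_tuple_lt q i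
      rw [hg, Pi.smul_apply, smul_eq_mul, mul_comm] at h1
      exact (Polynomial.degree_le_mul_left _ hg0).trans_lt h1
    obtain ⟨c, rfl⟩ := exists_tuple_eq hpe
    -- if all the `c i` had degree `< e`, they would violate the minimality of `e`
    have hc : AreCoprime c := by
      refine (areCoprime_iff c).2 ⟨hp, ?_⟩
      by_contra! hlast
      refine hn ?_
      obtain ⟨c', hc'⟩ := exists_tuple_eq (n := e) (P := tuple (e + 1) c) fun i => by
        rw [Polynomial.degree_lt_iff_coeff_zero]
        intro m hm
        rcases hm.eq_or_lt with rfl | hm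
        · exact (coeff_tuple c i (Fin.last e)).trans (hlast i)
        · exact Polynomial.coeff_eq_zero_of_degree_lt
            ((hpe i).trans_le (by exact_mod_cast hm))
      refine ⟨c', ?_, (cross_eq_zero_iff_of_eq_smul hh hp hFp).2 ⟨1, by rw [hc', one_smul]⟩⟩
      rintro rfl
      exact hp.ne_zero (hc'.symm.trans (map_zero _))
    obtain ⟨h', rfl⟩ := exists_ofFn_eq (n := k + 1) (g := h) <|
      hc.degree_lt (m := e + k + 1) (by ring) fun i => by
        have h1 := degree_tuple_lt F i
        rwa [hFp] at h1
    refine ⟨c, h', hc, ?_, hFp⟩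
    rintro rfl
    exact hh (map_zero _)
  · rintro ⟨c, h, hc, h0, hFc⟩
    have hp := ((areCoprime_iff c).1 hc).1
    have hh : ofFn (k + 1) h ≠ 0 := fun h1 =>
      h0 (Polynomial.injective_ofFn _ (h1.trans (map_zero _).symm))
    refine ⟨⟨c, hc.ne_zero, (cross_eq_zero_iff_of_eq_smul hh hp hFc).2 ⟨1, by simp⟩⟩, ?_⟩
    rintro ⟨q, hq0, hq⟩
    obtain ⟨g, hg⟩ := (cross_eq_zero_iff_of_eq_smul hh hp hFc).1 hq
    have hdeg : g.degree < (0 : ℕ) := hc.degree_lt (Nat.zero_add e).symm fun i => by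
      have := degree_tuple_lt q i
      rwa [hg] at this
    have : g = 0 := by
      by_contra hg0
      rw [Polynomial.degree_eq_natDegree hg0] at hdeg
      exact absurd (Nat.cast_lt.1 hdeg) (Nat.not_lt_zero _)
    rw [this, zero_smul] at hg
    exact hq0 (tuple_injective _ (hg.trans (map_zero _).symm))

end Forms

/-! ### The moduli property of the space of maps -/

section Moduli

variable {r d : ℕ}

/-- Homogeneous polynomials of degree `d` in two variables are binary forms of degree `d`. -/
theorem exists_eval_eq_formValues {F : Fin (r + 1) → MvPolynomial (Fin 2) ℂ}
    (hF : ∀ i, (F i).IsHomogeneous d) : ∃ c : Fin (r + 1) × Fin (d + 1) → ℂ,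
      ∀ v : Fin 2 → ℂ, (fun i => eval v (F i)) = formValues c v := by
  let m : ℕ → Fin 2 →₀ ℕ := fun k => Finsupp.equivFunOnFinite.symm ![k, d - k]
  have hm : ∀ i, ∀ s ∈ (F i).support, s 0 + s 1 = d := by
    intro i s hs
    have h := hF i (mem_support_iff.1 hs)
    simpa [Finsupp.weight_apply, Finsupp.sum_fintype] using h
  have hms : ∀ i, ∀ s ∈ (F i).support, m (s 0) = s := by
    intro i s hs
    have := hm i s hs
    ext b
    fin_cases b
    · simp [m]
    · simp [m]
      omega
  refine ⟨fun ik => (F ik.1).coeff (m ik.2), fun v => _root_.funext fun i => ?_⟩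
  rw [eval_eq']
  refine Finset.sum_of_injOn (fun s => Fin.ofNat (d + 1) (s 0)) ?_ (fun _ _ => by simp) ?_ ?_
  · intro s hs s' hs' h
    have h1 := hm i s hs
    have h2 := hm i s' hs'
    have h3 : s 0 = s' 0 := by
      have := congrArg Fin.val h
      simpa [Fin.val_ofNat, Nat.mod_eq_of_lt (show s 0 < d + 1 by omega),
        Nat.mod_eq_of_lt (show s' 0 < d + 1 by omega)] using this
    rw [← hms i s hs, ← hms i s' hs', h3]
  · intro k _ hk
    have : (F i).coeff (m k) = 0 := by
      by_contra h0
      refine hk ⟨m k, mem_support_iff.2 h0, Fin.ext ?_⟩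
      simp [m]
    simp [this]
  · intro s hs
    have h1 := hm i s hs
    have h2 : s 0 % (d + 1) = s 0 := Nat.mod_eq_of_lt (by omega)
    have h3 : d - s 0 = s 1 := by omega
    simp only [Fin.val_ofNat, h2, hms i s hs, Fin.prod_univ_two, h3]
    ring

/-- The point of `Map(r, d)` given by forms without common zero. -/
noncomputable def mapMk (c : Fin (r + 1) × Fin (d + 1) → ℂ) (hc : AreCoprime c) :
    (mapVariety r d).carrier :=
  ⟨Projectivization.mk ℂ c hc.ne_zero, by
    obtain ⟨a, ha, h⟩ := exists_rep_eq_smul c hc.ne_zero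
    change AreCoprime _
    rw [h]
    exact hc.smul ha⟩

theorem IsMapOfDegree.exists_mapEval_eq {φ : (projSpace 1).carrier → (projSpace r).carrier}
    (hφ : IsMapOfDegree d φ) : ∃ p, φ = mapEval r d p := by
  obtain ⟨F, hF, h⟩ := hφ
  obtain ⟨c, hc⟩ := exists_eval_eq_formValues hF
  simp only [hc] at h
  have hco : AreCoprime c := by
    intro v hv h0
    obtain ⟨h1, -⟩ := h ⟨Projectivization.mk ℂ v hv, trivial⟩
    obtain ⟨a, ha, hae⟩ := exists_rep_eq_smul v hv
    refine h1 ?_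
    change formValues c (Projectivization.mk ℂ v hv).rep = 0
    rw [hae, formValues_smul, h0, smul_zero]
  refine ⟨mapMk c hco, _root_.funext fun q => Subtype.ext ?_⟩
  obtain ⟨a, ha, hae⟩ := exists_rep_eq_smul c hco.ne_zero
  obtain ⟨h1, h2⟩ := h q
  rw [h2]
  refine (mk_congr _ _ a ?_).symm
  change _ = formValues (Projectivization.mk ℂ c hco.ne_zero).rep q.1.rep
  rw [hae, formValues_smul_left]

theorem isMapOfDegree_mapEval (p : (mapVariety r d).carrier) :
    IsMapOfDegree d (mapEval r d p) := by
  have key : ∀ v : Fin 2 → ℂ, (fun i => eval v (∑ k : Fin (d + 1),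
      C (p.1.rep (i, k)) * X 0 ^ (k : ℕ) * X 1 ^ (d - k))) = formValues p.1.rep v := by
    intro v
    ext i
    simp [formValues]
  refine ⟨fun i => ∑ k : Fin (d + 1), C (p.1.rep (i, k)) * X 0 ^ (k : ℕ) * X 1 ^ (d - k),
    fun i => IsHomogeneous.sum _ _ _ fun k _ => ?_, fun q => ⟨?_, ?_⟩⟩
  · have h := ((isHomogeneous_C (Fin 2) (p.1.rep (i, k))).mul
      (isHomogeneous_X_pow (R := ℂ) (0 : Fin 2) (k : ℕ))).mul
      (isHomogeneous_X_pow (R := ℂ) (1 : Fin 2) (d - k))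
    have hk : 0 + (k : ℕ) + (d - k) = d := by omega
    rwa [hk] at h
  · rw [key]
    exact p.2 _ q.1.rep_nonzero
  · simp only [key]
    rfl

/-- The point `[t : 1]` of `ℙ¹`. -/
noncomputable def linePoint (t : ℂ) : (projSpace 1).carrier :=
  ⟨Projectivization.mk ℂ ![t, 1] (Function.ne_iff.2 ⟨1, by simp⟩), trivial⟩

theorem formValues_linePoint (c : Fin (r + 1) × Fin (d + 1) → ℂ) (t : ℂ) : ∃ a : ℂ, a ≠ 0 ∧
    formValues c (linePoint t).1.rep = a • fun i => (tuple (d + 1) c i).eval t := by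
  obtain ⟨a, ha, h⟩ := exists_rep_eq_smul ![t, 1] (Function.ne_iff.2 ⟨1, by simp⟩)
  refine ⟨a ^ d, pow_ne_zero _ ha, ?_⟩
  change formValues c (Projectivization.mk ℂ ![t, 1] _).rep = _
  rw [h, formValues_smul]
  congr 1
  exact _root_.funext fun i => formValues_eq_eval_tuple c t i

theorem exists_smul_of_mapEval_eq_mk {p : (mapVariety r d).carrier} {t : ℂ}
    {w : Fin (r + 1) → ℂ} {hw : w ≠ 0}
    (h : (mapEval r d p (linePoint t)).1 = Projectivization.mk ℂ w hw) :
    ∃ b : ℂ, b ≠ 0 ∧ w = b • fun i => (tuple (d + 1) p.1.rep i).eval t := by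
  obtain ⟨a, ha, hae⟩ := formValues_linePoint p.1.rep t
  obtain ⟨b, hb⟩ := (Projectivization.mk_eq_mk_iff' ℂ _ _ _ _).1 h.symm
  rw [hae, smul_smul] at hb
  refine ⟨b * a, fun h0 => hw ?_, hb.symm⟩
  rw [← hb, h0, zero_smul]

/-- Coprime forms are determined up to a scalar by the map `ℙ¹ → ℙʳ` they define. -/
theorem mapEval_injective : Function.Injective (mapEval r d) := by
  intro p p' h
  have hpt : ∀ t : ℂ, ∃ b : ℂ, (fun i => (tuple (d + 1) p.1.rep i).eval t) =
      b • fun i => (tuple (d + 1) p'.1.rep i).eval t := by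
    intro t
    obtain ⟨a, ha, hae⟩ := formValues_linePoint p.1.rep t
    obtain ⟨b, hb, hbe⟩ := exists_smul_of_mapEval_eq_mk
      (show (mapEval r d p' (linePoint t)).1 = _ by rw [← h]; rfl)
    refine ⟨a⁻¹ * b, ?_⟩
    rw [mul_smul, ← hbe, hae, smul_smul, inv_mul_cancel₀ ha, one_smul]
  obtain ⟨a, ha⟩ := AreCoprime.exists_eq_smul (c := p'.1.rep) (q := p.1.rep) p'.2 <| by
    refine fun i j => Polynomial.funext fun t => ?_
    obtain ⟨b, hb⟩ := hpt t
    have h1 := congrFun hb i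
    have h2 := congrFun hb j
    simp only [Pi.smul_apply, smul_eq_mul] at h1 h2
    rw [Polynomial.eval_mul, Polynomial.eval_mul, h1, h2]
    ring
  refine Subtype.ext ?_
  rw [← Projectivization.mk_rep p.1, ← Projectivization.mk_rep p'.1]
  exact mk_congr _ _ a ha.symm

theorem isRegular_mapEval : IsRegular (X := (mapVariety r d).prod (projSpace 1))
    (Y := projSpace r) (fun z => mapEval r d
      (((mapVariety r d).prodEquiv (projSpace 1)).symm z).1
      (((mapVariety r d).prodEquiv (projSpace 1)).symm z).2) := by
  intro z
  obtain ⟨⟨c, q⟩, rfl⟩ := ((mapVariety r d).prodEquiv (projSpace 1)).surjective z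
  obtain ⟨m, hm⟩ := Function.ne_iff.1 c.1.rep_nonzero
  obtain ⟨j, hj⟩ := Function.ne_iff.1 q.1.rep_nonzero
  simp only [Pi.zero_apply] at hm hj
  -- the forms have bidegree `(1, d)`; multiplied by `c m ^ d * q j`, they have bidegree
  -- `(d + 1, d + 1)` and become polynomials of degree `d + 1` in the Segre coordinates
  let F : Fin (r + 1) → MvPolynomial ((Fin (r + 1) × Fin (d + 1)) × Fin 2) ℂ := fun i =>
    ∑ k : Fin (d + 1), X ((i, k), j) * X (m, 0) ^ (k : ℕ) * X (m, 1) ^ (d - k)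
  have hF : ∀ i, (F i).IsHomogeneous (d + 1) := by
    refine fun i => IsHomogeneous.sum _ _ _ fun k _ => ?_
    have h := ((isHomogeneous_X ℂ (((i, k), j) : (Fin (r + 1) × Fin (d + 1)) × Fin 2)).mul
      (isHomogeneous_X_pow (R := ℂ) (m, (0 : Fin 2)) (k : ℕ))).mul
      (isHomogeneous_X_pow (R := ℂ) (m, (1 : Fin 2)) (d - k))
    have hk : 1 + (k : ℕ) + (d - k) = d + 1 := by omega
    rwa [hk] at h
  refine isRegularAt_of_guard (S := X (m, j)) (isHomogeneous_X ℂ _) ?_ hF ?_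
  · obtain ⟨a, ha, hae⟩ := (mapVariety r d).prodEquiv_rep (projSpace 1) c q
    rw [eval_X, hae]
    exact mul_ne_zero ha (mul_ne_zero hm hj)
  · intro y hy
    obtain ⟨⟨c', q'⟩, rfl⟩ := ((mapVariety r d).prodEquiv (projSpace 1)).surjective y
    obtain ⟨a, ha, hae⟩ := (mapVariety r d).prodEquiv_rep (projSpace 1) c' q'
    rw [eval_X, hae] at hy
    obtain ⟨b, hb, hbe⟩ := exists_rep_eq_smul _ (c'.2 _ q'.1.rep_nonzero)
    simp only [Equiv.symm_apply_apply]
    refine ⟨a ^ (d + 1) * q'.1.rep j * c'.1.rep m ^ d, b, ?_, ?_⟩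
    · simp only [ne_eq, mul_eq_zero, not_or] at hy
      exact mul_ne_zero (mul_ne_zero (pow_ne_zero _ ha) hy.2.2) (pow_ne_zero _ hy.2.1)
    · change _ • (Projectivization.mk ℂ (formValues c'.1.rep q'.1.rep) _).rep = _
      rw [hbe]
      ext i
      simp only [F, Pi.smul_apply, smul_eq_mul, formValues, map_sum, map_mul, map_pow, eval_X, hae,
        Finset.mul_sum]
      refine Finset.sum_congr rfl fun k _ => ?_
      have h1 : a ^ (d + 1) = a * a ^ (k : ℕ) * a ^ (d - k) := by
        rw [mul_assoc, ← pow_add, ← pow_succ']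
        congr 2
        omega
      have h2 : c'.1.rep m ^ d = c'.1.rep m ^ (k : ℕ) * c'.1.rep m ^ (d - k) := by
        rw [← pow_add]
        congr 1
        omega
      rw [h1, h2]
      ring

/-- The inclusion of a slice `X × {y}` of `X × Y` is regular. -/
theorem isRegular_slice (X Y : Variety) (y : Y.carrier) :
    IsRegular (fun x : X.carrier => X.prodEquiv Y (x, y)) := by
  have key : ∀ x : X.carrier, (fun ij : X.ι × Y.ι =>
      eval x.1.rep (C (y.1.rep ij.2) * MvPolynomial.X ij.1)) =
      fun ij : X.ι × Y.ι => x.1.rep ij.1 * y.1.rep ij.2 := fun x => by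
    ext ij
    simp [mul_comm]
  refine fun x => ⟨1, fun ij => C (y.1.rep ij.2) * MvPolynomial.X ij.1,
    fun ij => isHomogeneous_C_mul_X _ _, ?_, fun x' hx' => ?_⟩
  · rw [key]
    exact segre_ne_zero x.1.rep_nonzero y.1.rep_nonzero
  · simp only [key]
    rfl

/-- The conditions on a sequence `q` of forms of degree `d` to take, up to scalars, the values
`w j` at the points `0, …, 2 d`. Since forms of degree `2 d` are determined by their values at
these points, they characterize the coefficients of a map of degree `d` up to a scalar. -/
noncomputable def interpolation (r d : ℕ) : (Fin (2 * d + 1) × Fin (r + 1) → ℂ) →ₗ[ℂ]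
    (Fin (r + 1) × Fin (d + 1) → ℂ) →ₗ[ℂ] Fin (2 * d + 1) → Fin (r + 1) → Fin (r + 1) → ℂ :=
  LinearMap.mk₂ ℂ (fun w q j i l => w (j, i) * (tuple (d + 1) q l).eval (j : ℂ) -
      w (j, l) * (tuple (d + 1) q i).eval (j : ℂ))
    (fun w w' q => by ext j i l; simp only [Pi.add_apply]; ring)
    (fun a w q => by ext j i l; simp only [Pi.smul_apply, smul_eq_mul]; ring)
    (fun w q q' => by ext j i l; simp only [map_add, Pi.add_apply, Polynomial.eval_add]; ring)
    (fun a w q => by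
      ext j i l
      simp only [map_smul, Pi.smul_apply, Polynomial.eval_smul, smul_eq_mul]
      ring)

theorem interpolation_eq_zero_iff {w : Fin (2 * d + 1) × Fin (r + 1) → ℂ}
    {q : Fin (r + 1) × Fin (d + 1) → ℂ} : interpolation r d w q = 0 ↔ ∀ j i l,
      w (j, i) * (tuple (d + 1) q l).eval (j : ℂ) =
        w (j, l) * (tuple (d + 1) q i).eval (j : ℂ) := by
  simp only [_root_.funext_iff, interpolation, LinearMap.mk₂_apply, Pi.zero_apply, sub_eq_zero]

theorem exists_eq_smul_of_interpolation_eq_zero {w : Fin (2 * d + 1) × Fin (r + 1) → ℂ}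
    {c q : Fin (r + 1) × Fin (d + 1) → ℂ} (hc : AreCoprime c)
    (hw : ∀ j, ∃ b : ℂ, b ≠ 0 ∧ ∀ i, w (j, i) = b * (tuple (d + 1) c i).eval (j : ℂ))
    (h : interpolation r d w q = 0) : ∃ a : ℂ, q = a • c := by
  rw [interpolation_eq_zero_iff] at h
  refine hc.exists_eq_smul fun i l => sub_eq_zero.1 ?_
  have hdeg : ∀ (c : Fin (r + 1) × Fin (d + 1) → ℂ) i, (tuple (d + 1) c i).natDegree ≤ d :=
    fun c i => Nat.lt_succ_iff.1 (Polynomial.ofFn_natDegree_lt (by omega) _)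
  refine Polynomial.eq_zero_of_natDegree_lt_card_of_eval_eq_zero _
    (f := fun j : Fin (2 * d + 1) => (j : ℂ)) ?_ (fun j => ?_) ?_
  · intro j j' hj
    exact Fin.ext (Nat.cast_injective hj)
  · obtain ⟨b, hb, hbe⟩ := hw j
    have := h j i l
    rw [hbe, hbe] at this
    refine mul_left_cancel₀ hb ?_
    simp only [Polynomial.eval_sub, Polynomial.eval_mul]
    linear_combination this
  · rw [Fintype.card_fin]
    have h2 : ∀ i l, (tuple (d + 1) c i * tuple (d + 1) q l).natDegree ≤ 2 * d := fun i l =>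
      Polynomial.natDegree_mul_le.trans (by linarith [hdeg c i, hdeg q l])
    exact Nat.lt_succ_iff.2 ((Polynomial.natDegree_sub_le_of_le (h2 i l) (h2 l i)).trans_eq
      (max_self _))

/-- The coefficients of a family of maps are regular functions of the parameter: they are
determined by linear equations in terms of the values of the maps at finitely many points. -/
theorem IsMapFamily.isRegular {T : Variety}
    {Φ : T.carrier → (projSpace 1).carrier → (projSpace r).carrier} (hΦ : IsMapFamily d T Φ)
    {g : T.carrier → (mapVariety r d).carrier} (hg : ∀ t, Φ t = mapEval r d (g t)) :
    IsRegular g := by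
  intro t
  have hreg : ∀ q, IsRegular (X := T) (Y := projSpace r) (fun t => Φ t q) := by
    intro q
    have := hΦ.regular.comp (isRegular_slice T (projSpace 1) q)
    simpa [Function.comp_def] using this
  -- near `t`, the value at the point `j` is given by polynomials `W j` of degree `n j`
  choose n W hW hWt hWe using fun j : Fin (2 * d + 1) => hreg (linePoint (j : ℂ)) t
  choose l hl using fun j => Function.ne_iff.1 (hWt j)
  obtain ⟨k, hk⟩ := Function.ne_iff.1 t.1.rep_nonzero
  have hn : ∀ j, n j ≤ ∑ j, n j := fun j => Finset.single_le_sum (fun _ _ => Nat.zero_le _)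
    (Finset.mem_univ j)
  have key : ∀ y : T.carrier, (∀ j, eval y.1.rep (W j (l j)) ≠ 0) → ∀ j, ∃ b : ℂ, b ≠ 0 ∧
      ∀ i, eval y.1.rep (W j i) = b * (tuple (d + 1) (g y).1.rep i).eval (j : ℂ) := by
    intro y hy j
    have h1 : (fun i => eval y.1.rep (W j i)) ≠ 0 := Function.ne_iff.2 ⟨l j, hy j⟩
    have h2 : (Φ y (linePoint (j : ℂ))).1 = _ := hWe j y h1
    rw [hg] at h2
    obtain ⟨b, hb, h⟩ := exists_smul_of_mapEval_eq_mk h2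
    exact ⟨b, hb, fun i => congrFun h i⟩
  -- the powers of `X k` give all the `W j` the same degree
  refine isRegularAt_of_kernel (interpolation r d) (S := ∏ j, W j (l j))
    (IsHomogeneous.prod Finset.univ _ n fun j _ => hW j (l j)) ?_
    (W := fun ji => W ji.1 ji.2 * X k ^ (∑ j, n j - n ji.1)) (n := ∑ j, n j) ?_ ?_ ?_
  · rw [map_prod]
    exact Finset.prod_ne_zero_iff.2 fun j _ => hl j
  · rintro ⟨j, i⟩
    have := (hW j i).mul (isHomogeneous_X_pow (R := ℂ) k (∑ j, n j - n j))
    rwa [Nat.add_sub_cancel' (hn j)] at this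
  · intro v hv
    refine exists_eq_smul_of_interpolation_eq_zero (g t).2 (fun j => ?_) hv
    obtain ⟨b, hb, h⟩ := key t hl j
    refine ⟨b * t.1.rep k ^ (∑ j, n j - n j), mul_ne_zero hb (pow_ne_zero _ hk), fun i => ?_⟩
    simp only [map_mul, map_pow, eval_X, h]
    ring
  · intro y hy
    rw [map_prod, Finset.prod_ne_zero_iff] at hy
    rw [interpolation_eq_zero_iff]
    intro j i l'
    obtain ⟨b, hb, h⟩ := key y (fun j => hy j (Finset.mem_univ j)) j
    simp only [map_mul, map_pow, eval_X, h]
    ring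

theorem isMapSpace_mapVariety (r d : ℕ) : IsMapSpace d (mapVariety r d) (mapEval r d) where
  family := ⟨isRegular_mapEval, isMapOfDegree_mapEval⟩
  universal T Φ hΦ := by
    choose g hg using fun t => (hΦ.degree t).exists_mapEval_eq
    exact ⟨g, ⟨hΦ.isRegular hg, hg⟩, fun g' hg' => _root_.funext fun t =>
      mapEval_injective ((hg'.2 t).symm.trans (hg t))⟩

end Moduli

/-! ### The stratification by the degree of the greatest common divisor -/

/-- A map is regular if it is induced by a linear map of the homogeneous coordinates. -/
theorem isRegular_of_linearMap {X Y : Variety} {f : X.carrier → Y.carrier}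
    (L : (X.ι → ℂ) →ₗ[ℂ] Y.ι → ℂ)
    (h : ∀ x, ∃ a : ℂ, a ≠ 0 ∧ a • (f x).1.rep = L x.1.rep) : IsRegular f := by
  classical
  have := X.finite_ι
  let _ := Fintype.ofFinite X.ι
  have key : ∀ v, (fun j => eval v (∑ i, C (L (Pi.single i 1) j) * MvPolynomial.X i)) = L v := by
    intro v
    conv_rhs => rw [pi_eq_sum_univ' v, map_sum]
    ext j
    simp [mul_comm]
  refine fun x => isRegularAt_of_guard (isHomogeneous_one _ _) (by simp)
    (F := fun j => ∑ i, C (L (Pi.single i 1) j) * MvPolynomial.X i) (n := 1)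
    (fun j => IsHomogeneous.sum _ _ _ fun i _ => isHomogeneous_C_mul_X _ _) fun y _ => ?_
  obtain ⟨a, ha, hy⟩ := h y
  exact ⟨a, 1, ha, by rw [key, hy, one_smul]⟩

/-- The projective space with homogeneous coordinates indexed by `ι`, as a variety. -/
abbrev fullSpace (ι : Type) [Finite ι] : Variety where
  ι := ι
  carrier := Set.univ
  locallyClosed := isZariskiClosed_univ.locallyClosed

section Strata

open Polynomial (ofFn)

variable {r : ℕ}

/-- The product of a sequence of forms of degree `e` and a form of degree `k`, as a linear map on
the tensor product of the spaces of coefficients. -/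
noncomputable def mulForms (r e k : ℕ) : ((Fin (r + 1) × Fin (e + 1)) × Fin (k + 1) → ℂ) →ₗ[ℂ]
    Fin (r + 1) × Fin (e + k + 1) → ℂ where
  toFun z im := (∑ b : Fin (k + 1),
    Polynomial.X ^ (b : ℕ) * tuple (e + 1) (fun s => z (s, b)) im.1).coeff im.2
  map_add' z z' := by
    ext im
    have : ∀ b i, tuple (e + 1) (fun s => z (s, b) + z' (s, b)) i =
        tuple (e + 1) (fun s => z (s, b)) i + tuple (e + 1) (fun s => z' (s, b)) i := fun b =>
      congrFun (map_add (tuple (e + 1)) (fun s => z (s, b)) fun s => z' (s, b))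
    simp only [this, Pi.add_apply, mul_add, Finset.sum_add_distrib, Polynomial.coeff_add]
  map_smul' a z := by
    ext im
    have : ∀ b i, tuple (e + 1) (fun s => a • z (s, b)) i =
        a • tuple (e + 1) (fun s => z (s, b)) i := fun b =>
      congrFun (map_smul (tuple (e + 1)) a fun s => z (s, b))
    simp only [this, Pi.smul_apply, mul_smul_comm, ← Finset.smul_sum,
      Polynomial.coeff_smul, RingHom.id_apply]

theorem tuple_mulForms {e k : ℕ} (z : (Fin (r + 1) × Fin (e + 1)) × Fin (k + 1) → ℂ)
    (i : Fin (r + 1)) : tuple _ (mulForms r e k z) i = ∑ b : Fin (k + 1),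
      Polynomial.X ^ (b : ℕ) * tuple (e + 1) (fun s => z (s, b)) i := by
  ext m
  rcases lt_or_ge m (e + k + 1) with hm | hm
  · exact coeff_tuple _ i ⟨m, hm⟩
  · rw [tuple_apply, Polynomial.ofFn_coeff_eq_zero_of_ge _ hm, Polynomial.finsetSum_coeff]
    symm
    refine Finset.sum_eq_zero fun b _ => ?_
    rw [Polynomial.coeff_X_pow_mul', if_pos (by omega), tuple_apply,
      Polynomial.ofFn_coeff_eq_zero_of_ge _ (by omega)]

theorem tuple_mulForms_of_eq {e k : ℕ} {z : (Fin (r + 1) × Fin (e + 1)) × Fin (k + 1) → ℂ}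
    {c : Fin (r + 1) × Fin (e + 1) → ℂ} {h : Fin (k + 1) → ℂ} (hz : ∀ s b, z (s, b) = c s * h b) :
    tuple _ (mulForms r e k z) = ofFn _ h • tuple _ c := by
  ext1 i
  have : ∀ b, (fun s => z (s, b)) = h b • c := fun b => by
    ext s
    rw [hz, Pi.smul_apply, smul_eq_mul, mul_comm]
  simp only [tuple_mulForms, this, map_smul, Pi.smul_apply, smul_eq_mul,
    Polynomial.ofFn_eq_sum_monomial, Finset.sum_mul]
  refine Finset.sum_congr rfl fun b _ => ?_
  rw [← Polynomial.C_mul_X_pow_eq_monomial, Polynomial.smul_eq_C_mul]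
  ring

/-- Linear equations for the pairs of a sequence of forms and a form with product proportional
to `F`, in the coordinates `z` of the Segre embedding: every sequence of forms contained in `z` is
proportional to `F` as a sequence of rational functions, and the product `mulForms r e k z` is
proportional to `F` as a vector. -/
noncomputable def factorization (r e k : ℕ) : (Fin (r + 1) × Fin (e + k + 1) → ℂ) →ₗ[ℂ]
    ((Fin (r + 1) × Fin (e + 1)) × Fin (k + 1) → ℂ) →ₗ[ℂ]
    (Fin (k + 1) → Fin (r + 1) → Fin (r + 1) → Polynomial ℂ) ×
      (Fin (r + 1) × Fin (e + k + 1) → Fin (r + 1) × Fin (e + k + 1) → ℂ) :=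
  LinearMap.mk₂ ℂ (fun F z => (fun b => cross (e + k + 1) (e + 1) F fun s => z (s, b),
      fun s s' => mulForms r e k z s * F s' - mulForms r e k z s' * F s))
    (fun F F' z => by
      ext1
      · ext1 b
        simp
      · ext s s'
        simp only [Prod.mk_add_mk, Pi.add_apply]
        ring)
    (fun a F z => by
      ext1
      · ext1 b
        simp
      · ext s s'
        simp only [Prod.smul_mk, Pi.smul_apply, smul_eq_mul]
        ring)
    (fun F z z' => by
      ext1
      · ext1 b
        exact map_add (cross (e + k + 1) (e + 1) F) (fun s => z (s, b)) fun s => z' (s, b)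
      · ext s s'
        simp only [map_add, Prod.mk_add_mk, Pi.add_apply]
        ring)
    (fun a F z => by
      ext1
      · ext1 b
        exact map_smul (cross (e + k + 1) (e + 1) F) a fun s => z (s, b)
      · ext s s'
        simp only [map_smul, Prod.smul_mk, Pi.smul_apply, smul_eq_mul]
        ring)

theorem factorization_eq_zero_iff {e k : ℕ} {F : Fin (r + 1) × Fin (e + k + 1) → ℂ}
    {z : (Fin (r + 1) × Fin (e + 1)) × Fin (k + 1) → ℂ} : factorization r e k F z = 0 ↔
      (∀ b, cross (e + k + 1) (e + 1) F (fun s => z (s, b)) = 0) ∧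
      ∀ s s', mulForms r e k z s * F s' = mulForms r e k z s' * F s := by
  simp only [factorization, LinearMap.mk₂_apply, Prod.mk_eq_zero, _root_.funext_iff (f := fun b =>
    cross (e + k + 1) (e + 1) F fun s => z (s, b)), Pi.zero_apply]
  refine and_congr Iff.rfl ?_
  simp only [_root_.funext_iff, Pi.zero_apply, sub_eq_zero]

/-- The coordinates of a point of `Map(r, e) × ℙᵏ`: a pure tensor, with coprime first factor. -/
def IsPure {e k : ℕ} (z : (Fin (r + 1) × Fin (e + 1)) × Fin (k + 1) → ℂ) : Prop :=
  ∃ (c : Fin (r + 1) × Fin (e + 1) → ℂ) (h : Fin (k + 1) → ℂ), AreCoprime c ∧ h ≠ 0 ∧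
    ∀ s b, z (s, b) = c s * h b

variable {e k : ℕ} {z : (Fin (r + 1) × Fin (e + 1)) × Fin (k + 1) → ℂ}

theorem IsPure.smul (hz : IsPure z) {a : ℂ} (ha : a ≠ 0) : IsPure (a • z) := by
  obtain ⟨c, h, hc, h0, hz⟩ := hz
  refine ⟨c, a • h, hc, smul_ne_zero ha h0, fun s b => ?_⟩
  simp [hz, mul_left_comm]

theorem IsPure.mulForms_ne_zero (hz : IsPure z) : mulForms r e k z ≠ 0 := by
  obtain ⟨c, h, hc, h0, hz⟩ := hz
  intro hF
  have h1 := tuple_mulForms_of_eq hz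
  rw [hF, map_zero] at h1
  rcases smul_eq_zero.1 h1.symm with h2 | h2
  · exact h0 (Polynomial.injective_ofFn _ (h2.trans (map_zero _).symm))
  · exact ((areCoprime_iff c).1 hc).1.ne_zero h2

theorem IsPure.exists_cross_eq_zero (hz : IsPure z) :
    (∃ q ≠ 0, cross _ (e + 1) (mulForms r e k z) q = 0) ∧
      ¬ ∃ q ≠ 0, cross _ e (mulForms r e k z) q = 0 := by
  rw [exists_cross_eq_zero_iff hz.mulForms_ne_zero]
  obtain ⟨c, h, hc, h0, hz⟩ := hz
  exact ⟨c, h, hc, h0, tuple_mulForms_of_eq hz⟩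

/-- The factorization of a sequence of forms as the product of a sequence of coprime forms and a
form is unique, and is characterized by linear equations. -/
theorem IsPure.factorization_eq_zero_iff (hz : IsPure z)
    {z' : (Fin (r + 1) × Fin (e + 1)) × Fin (k + 1) → ℂ} :
    factorization r e k (mulForms r e k z) z' = 0 ↔ ∃ a : ℂ, z' = a • z := by
  have hF := hz.mulForms_ne_zero
  obtain ⟨c, h, hc, h0, hz⟩ := hz
  have hh : ofFn (k + 1) h ≠ 0 := fun h1 =>
    h0 (Polynomial.injective_ofFn _ (h1.trans (map_zero _).symm))
  have hp := ((areCoprime_iff c).1 hc).1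
  have hcross : ∀ q : Fin (r + 1) × Fin (e + 1) → ℂ,
      cross (e + k + 1) (e + 1) (mulForms r e k z) q = 0 ↔ ∃ a : ℂ, q = a • c := by
    intro q
    rw [cross_eq_zero_iff_of_eq_smul hh hp (tuple_mulForms_of_eq hz)]
    constructor
    · rintro ⟨g, hg⟩
      refine hc.exists_eq_smul fun i j => ?_
      simp only [hg, Pi.smul_apply, smul_eq_mul]
      ring
    · rintro ⟨a, rfl⟩
      refine ⟨Polynomial.C a, _root_.funext fun i => ?_⟩
      rw [map_smul, Pi.smul_apply, Pi.smul_apply, smul_eq_mul, Polynomial.smul_eq_C_mul]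
  rw [QuasiProj.factorization_eq_zero_iff]
  constructor
  · rintro ⟨h1, h2⟩
    -- the first equations make `z'` a pure tensor `c ⊗ l`
    choose l hl using fun b => (hcross _).1 (h1 b)
    have hz' : ∀ s b, z' (s, b) = c s * l b := fun s b => by
      rw [mul_comm]
      exact congrFun (hl b) s
    -- by the second ones the products of `c` with `l` and with `h` are proportional
    obtain ⟨s, hs⟩ := Function.ne_iff.1 hF
    rw [Pi.zero_apply] at hs
    set a := mulForms r e k z' s / mulForms r e k z s with ha
    have h3 : mulForms r e k z' = a • mulForms r e k z := by
      ext s'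
      have := h2 s s'
      rw [Pi.smul_apply, smul_eq_mul, ha]
      field_simp
      linear_combination -this
    have h4 := congrArg (tuple _) h3
    rw [map_smul, tuple_mulForms_of_eq hz, tuple_mulForms_of_eq hz'] at h4
    obtain ⟨i, hi⟩ := Function.ne_iff.1 hp.ne_zero
    have h5 : l = a • h := Polynomial.injective_ofFn _ (mul_right_cancel₀ hi (by
      rw [map_smul, smul_mul_assoc]
      exact congrFun h4 i))
    refine ⟨a, _root_.funext fun sb => ?_⟩
    obtain ⟨s, b⟩ := sb
    rw [hz', Pi.smul_apply, hz, h5, Pi.smul_apply, smul_eq_mul, smul_eq_mul]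
    ring
  · rintro ⟨a, rfl⟩
    refine ⟨fun b => (hcross _).2 ⟨a * h b, _root_.funext fun s => ?_⟩, fun s s' => ?_⟩
    · simp only [Pi.smul_apply, smul_eq_mul, hz]
      ring
    · simp only [map_smul, Pi.smul_apply, smul_eq_mul]
      ring

theorem isPure_rep (z : ((mapVariety r e).prod (projSpace k)).carrier) : IsPure z.1.rep := by
  obtain ⟨⟨c, h⟩, rfl⟩ := ((mapVariety r e).prodEquiv (projSpace k)).surjective z
  obtain ⟨a, ha, hae⟩ := (mapVariety r e).prodEquiv_rep (projSpace k) c h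
  refine ⟨c.1.rep, a • h.1.rep, c.2, smul_ne_zero ha h.1.rep_nonzero, fun s b => ?_⟩
  rw [hae, Pi.smul_apply, smul_eq_mul]
  ring

theorem IsPure.exists_rep (hz : IsPure z) :
    ∃ (x : ((mapVariety r e).prod (projSpace k)).carrier) (a : ℂ), a ≠ 0 ∧ x.1.rep = a • z := by
  obtain ⟨c, h, hc, h0, hz⟩ := hz
  obtain ⟨a₁, h₁, e₁⟩ := exists_rep_eq_smul c hc.ne_zero
  obtain ⟨a₂, h₂, e₂⟩ := exists_rep_eq_smul h h0
  obtain ⟨a, ha, hae⟩ := (mapVariety r e).prodEquiv_rep (projSpace k) (mapMk c hc)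
    ⟨Projectivization.mk ℂ h h0, trivial⟩
  refine ⟨(mapVariety r e).prodEquiv (projSpace k)
    (mapMk c hc, ⟨Projectivization.mk ℂ h h0, trivial⟩), a * a₁ * a₂, by positivity,
    _root_.funext fun sb => ?_⟩
  obtain ⟨s, b⟩ := sb
  rw [hae s b]
  change a * ((Projectivization.mk ℂ c hc.ne_zero).rep s * (Projectivization.mk ℂ h h0).rep b) = _
  rw [e₁, e₂, Pi.smul_apply, Pi.smul_apply, Pi.smul_apply, hz]
  simp only [smul_eq_mul]
  ring

/-- The sequences of forms of degree `d` proportional to a sequence of polynomials of degree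
`< n`, i.e. with a common divisor of degree greater than `d - n`. -/
def locus (r d n : ℕ) : Set (ProjSpace (Fin (r + 1) × Fin (d + 1))) :=
  {p | ∃ q ≠ 0, cross (d + 1) n p.rep q = 0}

theorem isZariskiClosed_locus (r d n : ℕ) : IsZariskiClosed (locus r d n) := by
  have := isZariskiClosed_exists_ne_zero (cross (r := r) (d + 1) n)
    (W := fun s => X s) (n := 1) fun s => isHomogeneous_X ℂ s
  simp only [eval_X] at this
  exact this

/-- The sequences of forms of degree `d` whose greatest common divisor has degree `d - e`. -/
abbrev stratum (r d e : ℕ) : Variety :=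
  ((fullSpace (Fin (r + 1) × Fin (d + 1))).interClosed _
    (isZariskiClosed_locus r d (e + 1))).diffClosed _ (isZariskiClosed_locus r d e)

theorem mem_stratum_iff (p : ProjSpace (Fin (r + 1) × Fin (e + k + 1))) :
    p ∈ (stratum r (e + k) e).carrier ↔
      ∃ (z : _) (a : ℂ), IsPure z ∧ a ≠ 0 ∧ p.rep = a • mulForms r e k z := by
  have h1 : p ∈ (stratum r (e + k) e).carrier ↔
      (∃ q ≠ 0, cross _ (e + 1) p.rep q = 0) ∧ ¬ ∃ q ≠ 0, cross _ e p.rep q = 0 :=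
    and_congr (and_iff_right trivial) Iff.rfl
  rw [h1]
  constructor
  · rw [exists_cross_eq_zero_iff p.rep_nonzero]
    rintro ⟨c, h, hc, h0, hF⟩
    refine ⟨fun sb => c sb.1 * h sb.2, 1, ⟨c, h, hc, h0, fun _ _ => rfl⟩, one_ne_zero, ?_⟩
    rw [one_smul]
    exact tuple_injective _ (hF.trans (tuple_mulForms_of_eq fun _ _ => rfl).symm)
  · rintro ⟨z, a, hz, ha, h⟩
    rw [h, ← map_smul]
    exact (hz.smul ha).exists_cross_eq_zero

/-- The product of sequences of forms and forms identifies `Map(r, e) × ℙᵏ` with a stratum of the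
space of all sequences of forms of degree `e + k`. -/
theorem stratum_iso (r e k : ℕ) :
    Isomorphic ((mapVariety r e).prod (projSpace k)) (stratum r (e + k) e) := by
  have hrep : ∀ z : ((mapVariety r e).prod (projSpace k)).carrier, ∃ a : ℂ, a ≠ 0 ∧
      (Projectivization.mk ℂ _ (isPure_rep z).mulForms_ne_zero).rep =
        a • mulForms r e k z.1.rep := fun z => exists_rep_eq_smul _ _
  let μ : ((mapVariety r e).prod (projSpace k)).carrier → (stratum r (e + k) e).carrier := fun z =>
    ⟨Projectivization.mk ℂ _ (isPure_rep z).mulForms_ne_zero, by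
      obtain ⟨a, ha, h⟩ := hrep z
      exact (mem_stratum_iff _).2 ⟨_, a, isPure_rep z, ha, h⟩⟩
  -- the point `z` is the solution, unique up to scalars, of a linear system depending on `μ z`:
  -- hence `μ` is injective, and its inverse is regular
  have hker : ∀ z v, factorization r e k (μ z).1.rep v = 0 ↔ ∃ a : ℂ, v = a • z.1.rep := by
    intro z v
    obtain ⟨a, ha, h⟩ := hrep z
    change factorization r e k (Projectivization.mk ℂ _ _).rep v = 0 ↔ _
    rw [h, map_smul, LinearMap.smul_apply, smul_eq_zero, or_iff_right ha,
      (isPure_rep z).factorization_eq_zero_iff]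
  have hμ : Function.Bijective μ := by
    constructor
    · intro z z' h
      obtain ⟨a, ha⟩ := (hker z' z.1.rep).1 (h ▸ (hker z z.1.rep).2 ⟨1, (one_smul _ _).symm⟩)
      refine Subtype.ext ?_
      rw [← Projectivization.mk_rep z.1, ← Projectivization.mk_rep z'.1]
      exact mk_congr _ _ a ha.symm
    · rintro ⟨p, hp⟩
      obtain ⟨z, a, hz, ha, h⟩ := (mem_stratum_iff p).1 hp
      obtain ⟨x, b, hb, hx⟩ := hz.exists_rep
      refine ⟨x, Subtype.ext (mk_eq_of_smul_eq _ _ _ b a hb ?_).symm⟩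
      rw [h, hx, map_smul, smul_comm]
  have hμe : ∀ y, μ ((Equiv.ofBijective μ hμ).symm y) = y :=
    (Equiv.ofBijective μ hμ).apply_symm_apply
  refine ⟨Equiv.ofBijective μ hμ, isRegular_of_linearMap (mulForms r e k) fun z => ?_, fun x =>
    isRegularAt_of_kernel (factorization r e k) (S := 1) (isHomogeneous_one _ _) (by simp)
      (W := fun s => X s) (n := 1) (fun s => isHomogeneous_X ℂ s) (fun v hv => ?_) fun y _ => ?_⟩
  · obtain ⟨a, ha, h⟩ := hrep z
    refine ⟨a⁻¹, inv_ne_zero ha, ?_⟩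
    change a⁻¹ • (Projectivization.mk ℂ _ _).rep = _
    rw [h, smul_smul, inv_mul_cancel₀ ha, one_smul]
  · simp only [eval_X] at hv
    rw [← hμe x] at hv
    exact (hker _ _).1 hv
  · simp only [eval_X]
    have := (hker ((Equiv.ofBijective μ hμ).symm y) _).2 ⟨1, (one_smul _ _).symm⟩
    rwa [hμe] at this

end Strata

/-! ### Classes in the Grothendieck ring -/

theorem cls_scissor (X : Variety) {A : Set (ProjSpace X.ι)} (hA : IsZariskiClosed A) :
    cls X = cls (X.diffClosed A hA) + cls (X.interClosed A hA) := by
  rw [cls, cls, cls, ← map_add]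
  exact Ideal.Quotient.eq.2 (AddSubgroup.subset_closure ⟨X, A, hA, rfl⟩)

theorem Isomorphic.cls_eq {X Y : Variety} (h : Isomorphic X Y) : cls X = cls Y :=
  congrArg (fun x => Ideal.Quotient.mk scissorIdeal (FreeAbelianGroup.of x)) (Quotient.sound h)

theorem cls_prod (X Y : Variety) : cls (X.prod Y) = cls X * cls Y := by
  rw [cls, cls, cls, ← map_mul, gen_mul]

theorem cls_eq_zero {X : Variety} (hX : X.carrier = ∅) : cls X = 0 := by
  have h := cls_scissor X isZariskiClosed_univ
  have h1 : X.diffClosed _ isZariskiClosed_univ = X :=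
    Variety.ext rfl (heq_of_eq (by simp [hX]))
  have h2 : X.interClosed _ isZariskiClosed_univ = X :=
    Variety.ext rfl (heq_of_eq (Set.inter_univ _))
  rw [h1, h2] at h
  simpa using h

/-- An isomorphism induced by linear maps of the homogeneous coordinates that are inverse to each
other on the given varieties. -/
theorem isomorphic_of_linearMap {X Y : Variety} (L : (X.ι → ℂ) →ₗ[ℂ] Y.ι → ℂ)
    (L' : (Y.ι → ℂ) →ₗ[ℂ] X.ι → ℂ)
    (hL : ∀ x ∈ X.carrier, L' (L x.rep) = x.rep) (hL' : ∀ y ∈ Y.carrier, L (L' y.rep) = y.rep)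
    (h : ∀ x ∈ X.carrier, ∀ hx, Projectivization.mk ℂ (L x.rep) hx ∈ Y.carrier)
    (h' : ∀ y ∈ Y.carrier, ∀ hy, Projectivization.mk ℂ (L' y.rep) hy ∈ X.carrier) :
    Isomorphic X Y := by
  have h0 : ∀ x : X.carrier, L x.1.rep ≠ 0 := fun x hx => x.1.rep_nonzero <| by
    rw [← hL _ x.2, hx, map_zero]
  have h0' : ∀ y : Y.carrier, L' y.1.rep ≠ 0 := fun y hy => y.1.rep_nonzero <| by
    rw [← hL' _ y.2, hy, map_zero]
  let e : X.carrier ≃ Y.carrier :=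
    { toFun := fun x => ⟨_, h _ x.2 (h0 x)⟩
      invFun := fun y => ⟨_, h' _ y.2 (h0' y)⟩
      left_inv := fun x => by
        obtain ⟨a, ha, hae⟩ := exists_rep_eq_smul _ (h0 x)
        refine Subtype.ext (mk_eq_of_smul_eq _ _ _ a 1 ha ?_).symm
        simp only [hae, map_smul, hL _ x.2, one_smul]
      right_inv := fun y => by
        obtain ⟨a, ha, hae⟩ := exists_rep_eq_smul _ (h0' y)
        refine Subtype.ext (mk_eq_of_smul_eq _ _ _ a 1 ha ?_).symm
        simp only [hae, map_smul, hL' _ y.2, one_smul] }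
  refine ⟨e, isRegular_of_linearMap L fun x => ?_, isRegular_of_linearMap L' fun y => ?_⟩
  · obtain ⟨a, ha, hae⟩ := exists_rep_eq_smul _ (h0 x)
    refine ⟨a⁻¹, inv_ne_zero ha, ?_⟩
    change a⁻¹ • (Projectivization.mk ℂ _ (h0 x)).rep = _
    rw [hae, smul_smul, inv_mul_cancel₀ ha, one_smul]
  · obtain ⟨a, ha, hae⟩ := exists_rep_eq_smul _ (h0' y)
    refine ⟨a⁻¹, inv_ne_zero ha, ?_⟩
    change a⁻¹ • (Projectivization.mk ℂ _ (h0' y)).rep = _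
    rw [hae, smul_smul, inv_mul_cancel₀ ha, one_smul]

theorem isZariskiClosed_hyperplane (n : ℕ) :
    IsZariskiClosed {p : ProjSpace (Fin (n + 1)) | p.rep 0 = 0} :=
  ⟨{X 0}, by simpa using ⟨1, isHomogeneous_X ℂ _⟩, by simp⟩

/-- The affine space of dimension `n`, as the complement of a hyperplane in `ℙⁿ`. -/
abbrev affineSpace (n : ℕ) : Variety :=
  (projSpace n).diffClosed _ (isZariskiClosed_hyperplane n)

theorem mem_affineSpace {n : ℕ} {p : ProjSpace (Fin (n + 1))} :
    p ∈ (affineSpace n).carrier ↔ p.rep 0 ≠ 0 :=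
  and_iff_right trivial

theorem mk_mem_affineSpace {n : ℕ} {v : Fin (n + 1) → ℂ} {hv : v ≠ 0} :
    Projectivization.mk ℂ v hv ∈ (affineSpace n).carrier ↔ v 0 ≠ 0 := by
  obtain ⟨a, ha, h⟩ := exists_rep_eq_smul v hv
  rw [mem_affineSpace, h]
  simp [ha]

/-- `𝔸ⁿ⁺¹ ≅ 𝔸¹ × 𝔸ⁿ`: the point `[x₀ : x₁ : ⋯]` corresponds to `[x₀ : x₁]` and
`[x₀ : x₂ : x₃ : ⋯]`, so that its Segre coordinates are the products `x (σ i) * x (τ j)`, and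
`x i` is, up to the scalar `x₀`, the Segre coordinate of index `ρ i`. -/
theorem affineSpace_succ_iso (n : ℕ) :
    Isomorphic ((affineSpace 1).prod (affineSpace n)) (affineSpace (n + 1)) := by
  let σ : Fin 2 → Fin (n + 2) := Fin.cases 0 fun _ => 1
  let τ : Fin (n + 1) → Fin (n + 2) := Fin.cases 0 fun j => j.succ.succ
  let ρ : Fin (n + 2) → Fin 2 × Fin (n + 1) :=
    Fin.cases (0, 0) (Fin.cases (1, 0) fun j => (0, j.succ))
  have hρσ : ∀ i, ρ (σ i) = (i, 0) := by
    intro i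
    fin_cases i <;> rfl
  have hρτ : ∀ j, ρ (τ j) = (0, j) := by
    intro j
    refine Fin.cases ?_ (fun j => ?_) j <;> rfl
  have hστ : ∀ (x : Fin (n + 2) → ℂ) i, x (σ (ρ i).1) * x (τ (ρ i).2) = x 0 * x i := by
    intro x i
    refine Fin.cases rfl (fun i => ?_) i
    refine Fin.cases (mul_comm _ _) (fun i => rfl) i
  -- the points of the product satisfy the Segre relations, and their coordinate `(0, 0)` is nonzero
  have hmul : ∀ z ∈ ((affineSpace 1).prod (affineSpace n)).carrier, z.rep (0, 0) ≠ 0 ∧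
      ∀ i j, z.rep (i, 0) * z.rep (0, j) = z.rep (0, 0) * z.rep (i, j) := by
    rintro _ ⟨p, hp, q, hq, rfl⟩
    obtain ⟨a, ha, hae⟩ := segre_rep p q
    refine ⟨?_, fun i j => ?_⟩
    · rw [hae]
      exact mul_ne_zero ha (mul_ne_zero (mem_affineSpace.1 hp) (mem_affineSpace.1 hq))
    · simp only [hae]
      ring
  have h0 : ∀ x : (affineSpace (n + 1)).carrier, x.1.rep 0 ≠ 0 := fun x => mem_affineSpace.1 x.2
  have hσ0 : ∀ x : (affineSpace (n + 1)).carrier, x.1.rep ∘ σ ≠ 0 := fun x =>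
    Function.ne_iff.2 ⟨0, h0 x⟩
  have hτ0 : ∀ x : (affineSpace (n + 1)).carrier, x.1.rep ∘ τ ≠ 0 := fun x =>
    Function.ne_iff.2 ⟨0, h0 x⟩
  let g : (affineSpace (n + 1)).carrier → ((affineSpace 1).prod (affineSpace n)).carrier :=
    fun x => (affineSpace 1).prodEquiv (affineSpace n)
      (⟨Projectivization.mk ℂ _ (hσ0 x), mk_mem_affineSpace.2 (h0 x)⟩,
        ⟨Projectivization.mk ℂ _ (hτ0 x), mk_mem_affineSpace.2 (h0 x)⟩)
  have hg : ∀ x, ∃ a : ℂ, a ≠ 0 ∧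
      ∀ i j, (g x).1.rep (i, j) = a * (x.1.rep (σ i) * x.1.rep (τ j)) := by
    intro x
    obtain ⟨a, ha, hae⟩ := (affineSpace 1).prodEquiv_rep (affineSpace n)
      ⟨Projectivization.mk ℂ _ (hσ0 x), mk_mem_affineSpace.2 (h0 x)⟩
      ⟨Projectivization.mk ℂ _ (hτ0 x), mk_mem_affineSpace.2 (h0 x)⟩
    obtain ⟨b, hb, hbe⟩ := exists_rep_eq_smul _ (hσ0 x)
    obtain ⟨c, hc, hce⟩ := exists_rep_eq_smul _ (hτ0 x)
    refine ⟨a * b * c, mul_ne_zero (mul_ne_zero ha hb) hc, fun i j => (hae i j).trans ?_⟩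
    rw [hbe, hce]
    simp only [Pi.smul_apply, Function.comp_apply, smul_eq_mul]
    ring
  have hf0 : ∀ z : ((affineSpace 1).prod (affineSpace n)).carrier, z.1.rep ∘ ρ ≠ 0 := fun z =>
    Function.ne_iff.2 ⟨0, (hmul _ z.2).1⟩
  let f : ((affineSpace 1).prod (affineSpace n)).carrier → (affineSpace (n + 1)).carrier :=
    fun z => ⟨Projectivization.mk ℂ _ (hf0 z), mk_mem_affineSpace.2 (hmul _ z.2).1⟩
  have hf : ∀ z, ∃ a : ℂ, a ≠ 0 ∧ (f z).1.rep = a • (z.1.rep ∘ ρ) := fun z =>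
    exists_rep_eq_smul _ (hf0 z)
  have hext : ∀ {ι : Type} (p q : ProjSpace ι) (a b : ℂ), a ≠ 0 → a • p.rep = b • q.rep →
      p = q := fun p q a b ha h =>
    (mk_eq_of_smul_eq p _ q.rep_nonzero a b ha h).trans (Projectivization.mk_rep q)
  refine ⟨⟨f, g, fun z => Subtype.ext ?_, fun x => Subtype.ext ?_⟩,
    isRegular_of_linearMap (LinearMap.funLeft ℂ ℂ ρ) fun z => ?_, fun x => ?_⟩
  · obtain ⟨a, ha, hae⟩ := hg (f z)
    obtain ⟨b, hb, hbe⟩ := hf z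
    refine hext _ _ 1 (a * b ^ 2 * z.1.rep (0, 0)) one_ne_zero (_root_.funext fun ij => ?_)
    obtain ⟨i, j⟩ := ij
    have h2 := (hmul _ z.2).2 i j
    rw [one_smul, hae, hbe]
    simp only [Pi.smul_apply, Function.comp_apply, smul_eq_mul, hρσ, hρτ]
    linear_combination a * b ^ 2 * h2
  · obtain ⟨a, ha, hae⟩ := hg x
    obtain ⟨b, hb, hbe⟩ := hf (g x)
    refine hext _ _ 1 (a * b * x.1.rep 0) one_ne_zero (_root_.funext fun i => ?_)
    have h2 := hae (ρ i).1 (ρ i).2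
    rw [hστ] at h2
    rw [one_smul, hbe]
    simp only [Pi.smul_apply, Function.comp_apply, smul_eq_mul]
    rw [h2]
    ring
  · obtain ⟨a, ha, hae⟩ := hf z
    refine ⟨a⁻¹, inv_ne_zero ha, ?_⟩
    change a⁻¹ • (f z).1.rep = z.1.rep ∘ ρ
    rw [hae, smul_smul, inv_mul_cancel₀ ha, one_smul]
  · refine isRegularAt_of_guard (isHomogeneous_one _ _) (by simp)
      (F := fun ij => X (σ ij.1) * X (τ ij.2)) (n := 1 + 1)
      (fun ij => (isHomogeneous_X _ _).mul (isHomogeneous_X _ _)) fun y _ => ?_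
    obtain ⟨a, ha, hae⟩ := hg y
    refine ⟨1, a, one_ne_zero, _root_.funext fun ij => ?_⟩
    rw [one_smul]
    change (g y).1.rep (ij.1, ij.2) = _
    rw [hae]
    simp

theorem cls_affineSpace (n : ℕ) : cls (affineSpace n) = cls affineLine ^ n := by
  have h1 : affineSpace 1 = affineLine :=
    Variety.ext rfl (heq_of_eq (Set.ext fun _ => mem_affineSpace))
  induction n with
  | zero =>
    have h0 : affineSpace 0 = projSpace 0 := by
      refine Variety.ext rfl (heq_of_eq (Set.eq_univ_of_forall fun p => mem_affineSpace.2 ?_))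
      refine fun h => p.rep_nonzero (_root_.funext fun i => ?_)
      rwa [Subsingleton.elim (α := Fin 1) i 0]
    rw [h0, pow_zero]
    rfl
  | succ n ih => rw [← (affineSpace_succ_iso n).cls_eq, cls_prod, h1, ih, pow_succ']

theorem hyperplane_iso (n : ℕ) :
    Isomorphic ((projSpace (n + 1)).interClosed _ (isZariskiClosed_hyperplane (n + 1)))
      (projSpace n) := by
  let L' : (Fin (n + 1) → ℂ) →ₗ[ℂ] Fin (n + 2) → ℂ :=
    LinearMap.pi (Fin.cases 0 fun i => LinearMap.proj i)
  refine isomorphic_of_linearMap (LinearMap.funLeft ℂ ℂ Fin.succ) L' ?_ ?_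
    (fun _ _ _ => trivial) ?_
  · rintro x ⟨-, hx⟩
    ext i
    refine Fin.cases ?_ (fun i => ?_) i
    · exact (Set.mem_ofPred_eq ▸ hx).symm
    · rfl
  · intro y _
    rfl
  · refine fun y _ hy => ⟨trivial, ?_⟩
    obtain ⟨a, ha, h⟩ := exists_rep_eq_smul _ hy
    change (Projectivization.mk ℂ (L' y.rep) hy).rep 0 = 0
    rw [h]
    exact mul_zero a

theorem cls_projSpace (n : ℕ) :
    cls (projSpace n) = ∑ i ∈ Finset.range (n + 1), cls affineLine ^ i := by
  induction n with
  | zero =>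
    rw [Finset.sum_range_one, pow_zero]
    rfl
  | succ n ih =>
    rw [cls_scissor _ (isZariskiClosed_hyperplane (n + 1)), (hyperplane_iso n).cls_eq, ih,
      Finset.sum_range_succ _ (n + 1), add_comm]
    congr 1
    exact cls_affineSpace (n + 1)

theorem cls_fullSpace (ι : Type) [Fintype ι] [Nonempty ι] :
    cls (fullSpace ι) = ∑ i ∈ Finset.range (Fintype.card ι), cls affineLine ^ i := by
  obtain ⟨n, hn⟩ := Nat.exists_eq_succ_of_ne_zero (Fintype.card_ne_zero (α := ι))
  have e := Fintype.equivFinOfCardEq hn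
  have h : Isomorphic (fullSpace ι) (projSpace n) :=
    isomorphic_of_linearMap (LinearMap.funLeft ℂ ℂ e.symm) (LinearMap.funLeft ℂ ℂ e)
      (fun x _ => by ext i; simp [LinearMap.funLeft_apply])
      (fun y _ => by ext i; simp [LinearMap.funLeft_apply])
      (fun _ _ _ => trivial) (fun _ _ _ => trivial)
  rw [h.cls_eq, cls_projSpace, hn]

theorem locus_zero (r d : ℕ) : locus r d 0 = ∅ := by
  ext p
  simp only [Set.mem_empty_iff_false, iff_false]
  rintro ⟨q, hq, -⟩
  exact hq (Subsingleton.elim _ _)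

theorem locus_succ_self (r d : ℕ) : locus r d (d + 1) = Set.univ :=
  Set.eq_univ_of_forall fun p =>
    ⟨p.rep, p.rep_nonzero, cross_eq_zero_iff.2 fun _ _ => mul_comm _ _⟩

theorem locus_subset_succ (r d n : ℕ) : locus r d n ⊆ locus r d (n + 1) := by
  rintro p ⟨q, hq, h⟩
  obtain ⟨q', hq'⟩ := exists_tuple_eq (n := n + 1) (P := tuple n q) fun i =>
    (degree_tuple_lt q i).trans (by exact_mod_cast n.lt_succ_self)
  refine ⟨q', ?_, cross_eq_zero_iff.2 (hq' ▸ cross_eq_zero_iff.1 h)⟩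
  rintro rfl
  exact hq (tuple_injective _ (hq'.symm.trans ((map_zero _).trans (map_zero _).symm)))

/-- The class of `locus r d n`, by adding up the classes of the strata it is made of. -/
theorem cls_locus (r d n : ℕ) (hn : n ≤ d + 1) :
    cls ((fullSpace (Fin (r + 1) × Fin (d + 1))).interClosed _ (isZariskiClosed_locus r d n)) =
      ∑ e ∈ Finset.range n, cls (mapVariety r e) * cls (projSpace (d - e)) := by
  induction n with
  | zero =>
    rw [Finset.sum_range_zero]
    refine cls_eq_zero ?_
    simp [locus_zero]
  | succ n ih =>
    rw [cls_scissor _ (isZariskiClosed_locus r d n), Finset.sum_range_succ, ← ih (by omega),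
      add_comm]
    congr 1
    · refine congrArg cls (Variety.ext rfl (heq_of_eq ?_))
      simp [Set.inter_eq_self_of_subset_right (locus_subset_succ r d n)]
    · obtain ⟨k, rfl⟩ := Nat.exists_eq_add_of_le (Nat.lt_succ_iff.1 hn)
      rw [Nat.add_sub_cancel_left, ← cls_prod]
      exact (stratum_iso r n k).cls_eq.symm

/-- The stratification of the projective space of all sequences of forms of degree `d` by the
degree of their greatest common divisor. -/
theorem sum_cls_mapVariety_mul_cls_projSpace (r d : ℕ) :
    ∑ e ∈ Finset.range (d + 1), cls (mapVariety r e) * cls (projSpace (d - e)) =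
      ∑ i ∈ Finset.range ((r + 1) * (d + 1)), cls affineLine ^ i := by
  rw [← cls_locus r d (d + 1) le_rfl]
  have h := cls_fullSpace (Fin (r + 1) × Fin (d + 1))
  rw [Fintype.card_prod, Fintype.card_fin, Fintype.card_fin] at h
  rw [← h]
  exact congrArg cls (Variety.ext rfl (heq_of_eq (by simp [locus_succ_self])))

/-! ### Generating series -/

section Series

variable {R : Type*} [CommRing R]

theorem one_sub_X_mul_C_mul_mk_pow (a : R) :
    (1 - PowerSeries.X * PowerSeries.C a) * PowerSeries.mk (fun n => a ^ n) = 1 := by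
  ext n
  cases n with
  | zero => simp [sub_mul, mul_assoc, PowerSeries.coeff_one]
  | succ n =>
    simp [sub_mul, mul_assoc, PowerSeries.coeff_succ_X_mul, PowerSeries.coeff_one, pow_succ']

theorem one_sub_X_mul_mk_sum (g : ℕ → R) :
    (1 - PowerSeries.X) * PowerSeries.mk (fun n => ∑ i ∈ Finset.range (n + 1), g i) =
      PowerSeries.mk g := by
  ext n
  cases n with
  | zero => simp [sub_mul]
  | succ n => simp [sub_mul, PowerSeries.coeff_succ_X_mul, Finset.sum_range_succ _ (n + 1)]

/-- Splitting `1 + a + ⋯ + a ^ (m n - 1)` into blocks of length `m`. -/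
theorem sum_range_mul_pow (a : R) (m n : ℕ) : ∑ i ∈ Finset.range (m * n), a ^ i =
    ∑ j ∈ Finset.range n, (∑ i ∈ Finset.range m, a ^ i) * (a ^ m) ^ j := by
  induction n with
  | zero => simp
  | succ n ih =>
    rw [Nat.mul_succ, Finset.sum_range_add, ih, Finset.sum_range_succ, Finset.sum_mul _ _ (_ ^ n)]
    congr 1
    refine Finset.sum_congr rfl fun i _ => ?_
    rw [pow_add, pow_mul, mul_comm]

end Series

/-- The generating series, with the inverse of `1 - q [𝔸]ʳ⁺¹` written as a geometric series. By the
stratification its product with the series of the `[ℙᵏ] = 1 + ⋯ + [𝔸]ᵏ`, the inverse of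
`(1 - q) (1 - q [𝔸])`, is the series of the classes of the spaces of all sequences of forms. -/
theorem mk_cls_mapVariety (r : ℕ) : (PowerSeries.mk fun d => cls (mapVariety r d)) =
    (1 - PowerSeries.X * PowerSeries.C (cls affineLine)) *
      PowerSeries.mk (fun d => (cls affineLine ^ (r + 1)) ^ d) *
      PowerSeries.C (cls (projSpace r)) := by
  set L := cls affineLine with hL
  set M := PowerSeries.mk fun d => cls (mapVariety r d) with hM
  have h1 : M * PowerSeries.mk (fun n => ∑ i ∈ Finset.range (n + 1), L ^ i) =
      PowerSeries.mk fun n =>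
        ∑ j ∈ Finset.range (n + 1), cls (projSpace r) * (L ^ (r + 1)) ^ j := by
    ext d
    rw [PowerSeries.coeff_mul, PowerSeries.coeff_mk, cls_projSpace r, ← sum_range_mul_pow,
      ← sum_cls_mapVariety_mul_cls_projSpace,
      Finset.Nat.sum_antidiagonal_eq_sum_range_succ_mk]
    simp [M, cls_projSpace, hL]
  have h2 : PowerSeries.mk (fun n => cls (projSpace r) * (L ^ (r + 1)) ^ n) =
      PowerSeries.C (cls (projSpace r)) * PowerSeries.mk fun n => (L ^ (r + 1)) ^ n := by
    ext d
    simp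
  have h3 := one_sub_X_mul_C_mul_mk_pow L
  have h4 := congrArg ((1 - PowerSeries.X) * ·) h1
  simp only [mul_left_comm _ M, one_sub_X_mul_mk_sum, h2] at h4
  linear_combination (1 - PowerSeries.X * PowerSeries.C L) * h4 - M * h3

end QuasiProj

theorem mainTheorem5 (r : ℕ) :
    -- `Map(r, d)` is the space of maps of degree `d` from `ℙ¹` to `ℙʳ`
    (∀ d : ℕ, IsMapSpace d (mapVariety r d) (mapEval r d)) ∧
    -- the class of `Map(r, d)` in `K(V)`
    cls (mapVariety r 0) = cls (projSpace r) ∧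
    (∀ d : ℕ, 0 < d → cls (mapVariety r d) =
      cls affineLine ^ ((d - 1) * (r + 1) + 1) * (cls affineLine ^ r - 1) * cls (projSpace r)) ∧
    -- the generating series, where the denominator is invertible in `K(V)⟦q⟧`
    IsUnit (1 - PowerSeries.X * PowerSeries.C (cls affineLine ^ (r + 1)) : PowerSeries KV) ∧
    (PowerSeries.mk fun d => cls (mapVariety r d)) =
      (1 - PowerSeries.X * PowerSeries.C (cls affineLine)) *
        Ring.inverse (1 - PowerSeries.X * PowerSeries.C (cls affineLine ^ (r + 1))) *
        PowerSeries.C (cls (projSpace r)) := by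
  have hseries := mk_cls_mapVariety r
  have hgeom := one_sub_X_mul_C_mul_mk_pow (cls affineLine ^ (r + 1))
  have hunit := IsUnit.of_mul_eq_one _ hgeom
  have hinv : Ring.inverse (1 - PowerSeries.X * PowerSeries.C (cls affineLine ^ (r + 1))) =
      PowerSeries.mk fun d => (cls affineLine ^ (r + 1)) ^ d := by
    exact hunit.mul_left_cancel ((Ring.mul_inverse_cancel _ hunit).trans hgeom.symm)
  have hcoeff : ∀ d, cls (mapVariety r d) = PowerSeries.coeff d
      ((1 - PowerSeries.X * PowerSeries.C (cls affineLine)) *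
        PowerSeries.mk (fun d => (cls affineLine ^ (r + 1)) ^ d) *
        PowerSeries.C (cls (projSpace r))) := fun d => by
    rw [← hseries, PowerSeries.coeff_mk]
  refine ⟨fun d => isMapSpace_mapVariety r d, ?_, fun d hd => ?_, hunit, ?_⟩
  · rw [hcoeff]
    simp [sub_mul, mul_assoc]
  · obtain ⟨n, rfl⟩ : ∃ n, d = n + 1 := ⟨d - 1, by omega⟩
    rw [hcoeff, PowerSeries.coeff_mul_C, sub_mul, one_mul, mul_assoc, map_sub,
      PowerSeries.coeff_succ_X_mul, PowerSeries.coeff_C_mul, PowerSeries.coeff_mk,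
      PowerSeries.coeff_mk, Nat.add_sub_cancel]
    ring
  · rw [hinv]
    exact hseries
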